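/- For $\kappa,\mu\in\mathbb C$ let $W_{\kappa,\mu}(z)$ be the Whittaker $W$-function on the Riemann surface of $\log z$: for $2\mu\notin\mathbb Z$, $$W_{\kappa,\mu}(z)=\frac{\Gamma(-2\mu)}{\Gamma(\frac12-\mu-\kappa)}M_{\kappa,\mu}(z)+\frac{\Gamma(2\mu)}{\Gamma(\frac12+\mu-\kappa)}M_{\kappa,-\mu}(z),\qquad M_{\kappa,\mu}(z)=e^{-z/2}z^{\frac12+\mu}\sum_{n\ge0}\frac{(\frac12+\mu-\kappa)_n}{(1+2\mu)_n\,n!}z^n,$$ and for $2\mu\in\mathbb Z$ it is the limit of this expression in the second index; here $(a)_n=a(a+1)\cdots(a+n-1)$. Then for all $\kappa\in\mathbb C$ and all $z$ on the surface, $\mu\mapsto W_{\kappa,\mu}(z)$ is an entire function. Moreover, let $\kappa\in\mathbb C$, $\delta>0$, $\mu_0\in\mathbb C$, and let $U\subset\mathbb C$ be a bounded open neighbourhood of $\mu_0$. Then for every integer $m\ge0$, as $|z|\to\infty$ in the sector $|\arg z|\le\frac{3\pi}2-\delta$, there is the asymptotic expansion $$\frac{\partial^m}{\partial\mu^m}W_{\kappa,\mu}(z)\sim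 e^{-z/2}z^\kappa\sum_{n=0}^\infty\frac{\partial^m}{\partial\mu^m}\left[\frac{(\frac12+\mu-\kappa)_n(\frac12-\mu-\kappa)_n}{n!}\right](-z)^{-n},$$ uniformly for $\mu\in U$. That is, for all integers $m,N\ge0$ there are constants $C$ and $R>0$, depending only on $\kappa,\delta,U,m,N$, such that for all $\mu\in U$ and all $z$ with $|\arg z|\le\frac{3\pi}2-\delta$ and $|z|\ge R$, $$\left|\frac{\partial^m}{\partial\mu^m}W_{\kappa,\mu}(z)-e^{-z/2}z^\kappa\sum_{n=0}^{N-1}\frac{\partial^m}{\partial\mu^m}\left[\frac{(\frac12+\mu-\kappa)_n(\frac12-\mu-\kappa)_n}{n!}\right](-z)^{-n}\right|\le C\,\bigl|e^{-z/2}z^\kappa\bigr|\,|z|^{-N}.$$ -/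

import Mathlib

/-- The regularised Whittaker function `M_{κ,μ}(z) / Γ(1 + 2μ)`, that is
`e^{-z/2} z^{1/2+μ} ∑ₙ (1/2+μ-κ)ₙ / (Γ(1+2μ+n) n!) zⁿ`, at the point `z = e^w` of the Riemann
surface of the logarithm. The complex number `w = log |z| + i arg z` is the logarithm of `z` on that
surface, so `z ^ a = e^{a w}` for all `a : ℂ`. The function is entire in `κ`, `μ` and `w`. -/
noncomputable def whittakerMReg (κ μ w : ℂ) : ℂ :=
  Complex.exp (-Complex.exp w / 2) * Complex.exp ((1 / 2 + μ) * w) *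
    Complex.regularizedHGFun {1 / 2 + μ - κ} {1 + 2 * μ} (Complex.exp w)

/-- The connection formula
`Γ(-2μ) / Γ(1/2-μ-κ) * M_{κ,μ}(z) + Γ(2μ) / Γ(1/2+μ-κ) * M_{κ,-μ}(z)` for `W_{κ,μ}(z)`, where
`z = e^w` and `2μ` is not an integer. It is written through the regularised functions by means of
`Γ(2μ) Γ(1-2μ) = π / sin (2πμ) = -Γ(-2μ) Γ(1+2μ)`. (The reciprocal of `Γ` at a pole is `0`, also in
Lean, where `Complex.Gamma` has the value `0` at its poles.) -/
noncomputable def whittakerWGeneric (κ μ w : ℂ) : ℂ :=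
  Real.pi / Complex.sin (2 * Real.pi * μ) *
    (whittakerMReg κ (-μ) w / Complex.Gamma (1 / 2 + μ - κ) -
      whittakerMReg κ μ w / Complex.Gamma (1 / 2 - μ - κ))

open scoped Classical in
/-- The Whittaker function `W_{κ,μ}(z)` at the point `z = e^w` of the Riemann surface of the
logarithm: it is given by the connection formula if `2μ` is not an integer, and by the limit of this
formula in the second index if `2μ` is an integer (a removable singularity). -/
noncomputable def whittakerW (κ μ w : ℂ) : ℂ :=
  if ∃ n : ℤ, 2 * μ = n then
    Filter.limUnder (nhdsWithin μ {μ}ᶜ) (fun ν => whittakerWGeneric κ ν w)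
  else whittakerWGeneric κ μ w

/-- The coefficient `(1/2+μ-κ)ₙ (1/2-μ-κ)ₙ / n!` of `(-z)⁻ⁿ` in the asymptotic series of
`W_{κ,μ}(z)`; here `(a)ₙ = a (a+1) ⋯ (a+n-1)`. -/
noncomputable def whittakerCoeff (κ : ℂ) (n : ℕ) (μ : ℂ) : ℂ :=
  (ascPochhammer ℂ n).eval (1 / 2 + μ - κ) * (ascPochhammer ℂ n).eval (1 / 2 - μ - κ) /
    (n.factorial : ℂ)

open Complex MeasureTheory Filter Topology Set

/-! Put a = 1/2+μ-κ and c = μ+κ-1/2. If Re a > 0 and 2μ is not an integer, then for z > 0 the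
function e^{z/2} z^{-κ} W_{κ,μ}(z) equals Γ(a)⁻¹ ∫₀^∞ e^{-t} t^{a-1} (1+t/z)^c dt. Substituting t =
z^{1/3} r gives z^{a/3} Γ(a)⁻¹ ∫₀^∞ e^{-pr} r^{a-1} (1+s²r)^c dr with p = z^{1/3}, s = z^{-1/3}. For
|arg z| < 3π/2 both p and s lie in the right half plane: the integral converges and 1+s²r avoids the
cut. One integral thus continues W to the whole sector without rotating the contour
(`whittakerWGeneric_eq_laplaceInt`).

The formula for z > 0 rests on `laplaceInt_connection`. The Laplace integral and the two Frobenius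
solutions solve Kummer's equation, and the Wronskians, computed as z → 0, give the linear relation
between them. Expanding (1+s²r)^c binomially and integrating the remainder gives the expansion with
error O(|z|^{-N}) (`exists_norm_laplaceInt_sub_le`).

The restriction Re a > 0 is removed by a three-term recurrence in κ. Both W and its formal series
satisfy it, hence so do the remainders, and a bound at κ-1 and κ passes to κ+1
(`WhittakerRemBound.add_one`).

At 2μ ∈ ℤ the numerator of the connection formula vanishes with the simple zero of sin(2πμ), so W is
entire in μ (`differentiable_whittakerW`). The bound extends to these μ by continuity, and Cauchy's
estimate on unit circles in the μ-plane bounds all μ-derivatives of the remainder. -/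

/-- A parameter integral of functions that are holomorphic in the parameter and dominated by an
integrable function can be differentiated under the integral sign. -/
theorem hasDerivAt_integral_of_differentiableOn {α : Type*} [MeasurableSpace α] {ν : Measure α}
    {F : ℂ → α → ℂ} {F' : α → ℂ} {bound : α → ℝ} {z₀ : ℂ} {ε : ℝ} (hε : 0 < ε)
    (hmeas : ∀ z ∈ Metric.ball z₀ ε, AEStronglyMeasurable (F z) ν)
    (hdiff : ∀ᵐ x ∂ν, DifferentiableOn ℂ (fun z => F z x) (Metric.ball z₀ ε))
    (hF' : ∀ᵐ x ∂ν, HasDerivAt (fun z => F z x) (F' x) z₀)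
    (hbound : ∀ᵐ x ∂ν, ∀ z ∈ Metric.ball z₀ ε, ‖F z x‖ ≤ bound x) (hint : Integrable bound ν) :
    HasDerivAt (fun z => ∫ x, F z x ∂ν) (∫ x, F' x ∂ν) z₀ := by
  have hmem : z₀ ∈ Metric.ball z₀ ε := Metric.mem_ball_self hε
  have hF'meas : AEStronglyMeasurable F' ν := by
    -- Measurability of the derivative: it is an a.e. limit of difference quotients along a
    -- sequence.
    obtain ⟨u, hu⟩ := exists_seq_tendsto (𝓝[≠] z₀)
    have hu' := (tendsto_nhdsWithin_iff.1 hu).1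
    have hball : ∀ᶠ n in atTop, u n ∈ Metric.ball z₀ ε := hu' (Metric.ball_mem_nhds z₀ hε)
    obtain ⟨n₀, hn₀⟩ := eventually_atTop.1 hball
    refine aestronglyMeasurable_of_tendsto_ae atTop
      (f := fun n x => slope (fun z => F z x) z₀ (u (n + n₀))) (fun n => ?_) ?_
    · change AEStronglyMeasurable
        (fun x => (u (n + n₀) - z₀)⁻¹ • (F (u (n + n₀)) x - F z₀ x)) ν
      have h := (hmeas _ (hn₀ _ (Nat.le_add_left n₀ n))).sub (hmeas _ hmem)
      exact h.const_smul (u (n + n₀) - z₀)⁻¹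
    · filter_upwards [hF'] with x hx
      exact (hasDerivAt_iff_tendsto_slope.1 hx).comp (hu.comp (tendsto_add_atTop_nat n₀))
  refine (hasDerivAt_integral_of_dominated_loc_of_lip (bound := fun x => bound x / (ε / 2))
    (s := Metric.ball z₀ (ε / 2)) (Metric.ball_mem_nhds z₀ (by positivity)) ?_ ?_ hF'meas ?_ ?_
    hF').2
  · filter_upwards [Metric.ball_mem_nhds z₀ hε] with z hz using hmeas z hz
  · exact hint.mono' (hmeas _ hmem) (hbound.mono fun x hx => hx _ hmem)
  · filter_upwards [hdiff, hbound] with x hd hb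
    refine (convex_ball z₀ (ε / 2)).lipschitzOnWith_of_nnnorm_deriv_le (𝕜 := ℂ) (fun z hz => ?_)
      (fun z hz => ?_)
    · exact hd.differentiableAt (Metric.isOpen_ball.mem_nhds
        (Metric.ball_subset_ball (by linarith) hz))
    · have hsub : Metric.ball z (ε / 2) ⊆ Metric.ball z₀ ε :=
        Metric.ball_subset_ball' (by rw [Metric.mem_ball] at hz; linarith)
      have hr : ∀ r, 0 < r → r < ε / 2 → ‖deriv (fun z => F z x) z‖ ≤ bound x / r := by
        intro r hr hr'
        have hcb : Metric.closedBall z r ⊆ Metric.ball z₀ ε :=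
          (Metric.closedBall_subset_ball hr').trans hsub
        refine norm_deriv_le_of_forall_mem_sphere_norm_le hr ?_
          (fun y hy => hb y (hcb (Metric.sphere_subset_closedBall hy)))
        exact (hd.mono hcb).diffContOnCl_ball (subset_refl _)
      -- The closed disc of radius ε/2 need not lie in the open ball, so Cauchy's estimate is used
      -- for r < ε/2 and r tends to ε/2.
      have hlim : Tendsto (fun r : ℝ => bound x / r) (𝓝[<] (ε / 2)) (𝓝 (bound x / (ε / 2))) := by
        refine Tendsto.mono_left ?_ nhdsWithin_le_nhds
        exact tendsto_const_nhds.div tendsto_id (by positivity)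
      have hle : ‖deriv (fun z => F z x) z‖ ≤ bound x / (ε / 2) := by
        refine ge_of_tendsto hlim ?_
        filter_upwards [Ioo_mem_nhdsLT (show (0 : ℝ) < ε / 2 by positivity)] with r hr'
        exact hr r hr'.1 hr'.2
      rw [← NNReal.coe_le_coe]
      simpa [abs_of_pos hε, abs_div] using hle.trans (le_abs_self _)
  · exact hint.div_const _

/-! ### Bounds for (1+s²r)^c and its binomial remainder -/

theorem one_add_sq_mul_mem_slitPlane {s : ℂ} (hs : 0 < s.re) {r : ℝ} (hr : 0 ≤ r) :
    1 + s ^ 2 * r ∈ slitPlane := by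
  rw [mem_slitPlane_iff]
  by_cases h : s.im = 0
  · left
    simp [pow_two, h]
    positivity
  · rcases hr.eq_or_lt with rfl | hr
    · left; simp
    · right
      simp [pow_two, hr.ne']
      intro h'
      have : s.re * s.im = 0 := by linarith
      simp [h, hs.ne'] at this

/-- With x = |s|²r, the squared norm is (1-x)² + 4r(Re s)², to be compared with (1+x)² = (1-x)² +
4x. The number σ bounds the cosine of arg s from below. -/
theorem le_norm_one_add_sq_mul {s : ℂ} {σ : ℝ} (hσ : 0 ≤ σ) (hσ1 : σ ≤ 1) (hs : σ * ‖s‖ ≤ s.re)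
    {r : ℝ} (hr : 0 ≤ r) : σ * (1 + ‖s‖ ^ 2 * r) ≤ ‖1 + s ^ 2 * r‖ := by
  refine abs_le_of_sq_le_sq' ?_ (norm_nonneg _) |>.2
  have h1 : ‖1 + s ^ 2 * (r : ℂ)‖ ^ 2 = (1 - ‖s‖ ^ 2 * r) ^ 2 + 4 * r * s.re ^ 2 := by
    rw [Complex.sq_norm, Complex.sq_norm, normSq_apply, normSq_apply]
    simp [pow_two]
    ring
  have h2 : (σ * ‖s‖) ^ 2 ≤ s.re ^ 2 := by gcongr
  have h3 : σ ^ 2 ≤ 1 := pow_le_one₀ hσ hσ1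
  rw [h1]
  nlinarith [mul_le_mul_of_nonneg_left h2 hr,
    mul_le_mul_of_nonneg_right h3 (sq_nonneg (1 - ‖s‖ ^ 2 * r))]

/-- The argument of the base contributes at most e^{πK}. The upper bound for the base serves Re c ≥
0, and the lower bound with σ serves Re c ≤ 0. -/
theorem norm_one_add_sq_mul_cpow_le {s c : ℂ} {σ : ℝ} {K : ℕ} (hσ : 0 < σ) (hσ1 : σ ≤ 1)
    (hs : σ * ‖s‖ ≤ s.re) (hc : ‖c‖ ≤ K) {r : ℝ} (hr : 0 ≤ r) :
    ‖(1 + s ^ 2 * r) ^ c‖ ≤ (Real.exp Real.pi / σ) ^ K * (1 + ‖s‖ ^ 2 * r) ^ K := by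
  set z := 1 + s ^ 2 * (r : ℂ) with hz
  have hx : 1 ≤ 1 + ‖s‖ ^ 2 * r := by have : 0 ≤ ‖s‖ ^ 2 * r := by positivity
                                      linarith
  have hlow : σ * (1 + ‖s‖ ^ 2 * r) ≤ ‖z‖ := le_norm_one_add_sq_mul hσ.le hσ1 hs hr
  have hup : ‖z‖ ≤ 1 + ‖s‖ ^ 2 * r := by
    refine (norm_add_le _ _).trans ?_
    simp [abs_of_nonneg hr]
  have hzpos : 0 < ‖z‖ := lt_of_lt_of_le (by positivity) hlow
  have hre : |c.re| ≤ K := (abs_re_le_norm c).trans hc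
  have him : |c.im| ≤ K := (abs_im_le_norm c).trans hc
  rw [norm_cpow_of_ne_zero (norm_pos_iff.1 hzpos)]
  have h1 : (Real.exp (arg z * c.im))⁻¹ ≤ Real.exp Real.pi ^ K := by
    rw [← Real.exp_neg, ← Real.exp_nat_mul, Real.exp_le_exp]
    calc -(arg z * c.im) ≤ |arg z * c.im| := neg_le_abs _
      _ = |arg z| * |c.im| := abs_mul _ _
      _ ≤ Real.pi * K := by
        gcongr
        exact abs_arg_le_pi z
      _ = K * Real.pi := mul_comm _ _
  have h2 : ‖z‖ ^ c.re ≤ (1 / σ) ^ K * (1 + ‖s‖ ^ 2 * r) ^ K := by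
    have hσ' : 1 ≤ 1 / σ := by rw [le_div_iff₀ hσ]; linarith
    rcases le_total 0 c.re with h | h
    · calc ‖z‖ ^ c.re ≤ (1 + ‖s‖ ^ 2 * r) ^ c.re := by gcongr
        _ ≤ (1 + ‖s‖ ^ 2 * r) ^ (K : ℝ) := by
          gcongr
          exact (le_abs_self _).trans hre
        _ = 1 * (1 + ‖s‖ ^ 2 * r) ^ K := by rw [Real.rpow_natCast, one_mul]
        _ ≤ _ := by gcongr; exact one_le_pow₀ hσ'
    · calc ‖z‖ ^ c.re ≤ σ ^ c.re :=
          Real.rpow_le_rpow_of_nonpos hσ (by nlinarith) h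
        _ = (1 / σ) ^ (-c.re) := by
          rw [one_div, Real.inv_rpow hσ.le, Real.rpow_neg hσ.le, inv_inv]
        _ ≤ (1 / σ) ^ (K : ℝ) := by
          gcongr
          exact (neg_le_abs _).trans hre
        _ = (1 / σ) ^ K * 1 := by rw [Real.rpow_natCast, mul_one]
        _ ≤ _ := by gcongr; exact one_le_pow₀ hx
  calc ‖z‖ ^ c.re / Real.exp (arg z * c.im)
      = ‖z‖ ^ c.re * (Real.exp (arg z * c.im))⁻¹ := div_eq_mul_inv _ _
    _ ≤ ((1 / σ) ^ K * (1 + ‖s‖ ^ 2 * r) ^ K) * Real.exp Real.pi ^ K := by gcongr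
    _ = _ := by rw [div_pow, div_pow, one_pow]; ring

/-- This is x^K/K! ≤ e^x at x = τ/B + τr. It lets part of an exponential decay absorb polynomial
growth. -/
theorem one_add_mul_pow_le_exp {B τ r : ℝ} (hB : 0 < B) (hτ : 0 < τ) (hr : 0 ≤ r) (K : ℕ) :
    (1 + B * r) ^ K ≤ (B / τ) ^ K * K.factorial * Real.exp (τ / B) * Real.exp (τ * r) := by
  have h := Real.pow_div_factorial_le_exp (τ / B + τ * r) (by positivity) K
  rw [div_le_iff₀ (by positivity), Real.exp_add] at h
  have h1 : 1 + B * r = (B / τ) * (τ / B + τ * r) := by field_simp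
  rw [h1, mul_pow]
  calc (B / τ) ^ K * (τ / B + τ * r) ^ K
      ≤ (B / τ) ^ K * (Real.exp (τ / B) * Real.exp (τ * r) * K.factorial) := by gcongr
    _ = _ := by ring

/-- The coefficient of `uⁿ` in the binomial series of `(1 + u) ^ c`. -/
noncomputable def binomCoeff (c : ℂ) (n : ℕ) : ℂ :=
  (-1) ^ n * (ascPochhammer ℂ n).eval (-c) / n.factorial

theorem binomCoeff_succ (c : ℂ) (n : ℕ) :
    binomCoeff c (n + 1) * (n + 1) = c * binomCoeff (c - 1) n := by
  have h : ((n : ℂ) + 1) ≠ 0 := by exact_mod_cast n.succ_ne_zero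
  have h' : (n.factorial : ℂ) ≠ 0 := by exact_mod_cast n.factorial_ne_zero
  simp only [binomCoeff, ascPochhammer_succ_left, Nat.factorial_succ]
  simp only [Polynomial.eval_mul, Polynomial.eval_X, Polynomial.eval_comp, Polynomial.eval_add,
    Polynomial.eval_one]
  rw [show -(c - 1) = -c + 1 by ring]
  push_cast
  field_simp
  ring

/-- The remainder of the binomial series. -/
noncomputable def binomRem (N : ℕ) (c u : ℂ) : ℂ :=
  (1 + u) ^ c - ∑ n ∈ Finset.range N, binomCoeff c n * u ^ n

theorem hasDerivAt_binomRem_succ (N : ℕ) {c u : ℂ} (hu : 1 + u ∈ slitPlane) :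
    HasDerivAt (binomRem (N + 1) c) (c * binomRem N (c - 1) u) u := by
  have h1 : HasDerivAt (fun u : ℂ => (1 + u) ^ c) (c * (1 + u) ^ (c - 1) * 1) u :=
    ((hasDerivAt_id u).const_add 1).cpow_const hu
  have h2 : HasDerivAt (fun u : ℂ => ∑ n ∈ Finset.range (N + 1), binomCoeff c n * u ^ n)
      (∑ n ∈ Finset.range (N + 1), binomCoeff c n * (n * u ^ (n - 1))) u :=
    HasDerivAt.fun_sum fun n _ => (hasDerivAt_pow n u).const_mul _
  refine (h1.sub h2).congr_deriv ?_
  rw [Finset.sum_range_succ', binomRem, mul_sub, Finset.mul_sum, mul_one]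
  simp only [Nat.cast_zero, zero_mul, mul_zero, add_zero]
  congr 1
  refine Finset.sum_congr rfl fun n _ => ?_
  rw [← mul_assoc c, ← binomCoeff_succ]
  push_cast
  ring

/-- Induction on N: the remainder of order N+1 vanishes at u = 0, and its derivative is c times the
remainder of order N for the exponent c-1. The mean value inequality on [0, r] yields the factor
‖s‖²r. Each step enlarges the bound for the exponent by one, whence K+N. -/
theorem exists_norm_binomRem_le {σ : ℝ} (hσ : 0 < σ) (hσ1 : σ ≤ 1) (N K : ℕ) :
    ∃ C : ℝ, 0 ≤ C ∧ ∀ c : ℂ, ‖c‖ ≤ K → ∀ s : ℂ, 0 < s.re → σ * ‖s‖ ≤ s.re → ∀ r : ℝ, 0 ≤ r →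
      ‖binomRem N c (s ^ 2 * r)‖ ≤ C * (‖s‖ ^ 2 * r) ^ N * (1 + ‖s‖ ^ 2 * r) ^ (K + N) := by
  induction N generalizing K with
  | zero =>
    refine ⟨(Real.exp Real.pi / σ) ^ K, by positivity, fun c hc s _ hs r hr => ?_⟩
    simpa [binomRem] using norm_one_add_sq_mul_cpow_le hσ hσ1 hs hc hr
  | succ N ih =>
    obtain ⟨C, hC, h⟩ := ih (K + 1)
    refine ⟨K * C, by positivity, fun c hc s hs0 hs r hr => ?_⟩
    have hc1 : ‖c - 1‖ ≤ (K + 1 : ℕ) := by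
      refine (norm_sub_le _ _).trans ?_
      simpa using hc
    have hder : ∀ x ∈ Icc 0 r, HasDerivWithinAt (fun x : ℝ => binomRem (N + 1) c (s ^ 2 * x))
        (c * binomRem N (c - 1) (s ^ 2 * x) * s ^ 2) (Icc 0 r) x := by
      intro x hx
      have h1 := hasDerivAt_binomRem_succ N (c := c) (one_add_sq_mul_mem_slitPlane hs0 hx.1)
      have h2 : HasDerivAt (fun x : ℝ => s ^ 2 * (x : ℂ)) (s ^ 2 * 1) x :=
        (ofRealCLM.hasDerivAt (x := x)).const_mul (s ^ 2)
      rw [mul_one] at h2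
      exact (h1.comp x h2).hasDerivWithinAt
    have hmv := norm_image_sub_le_of_norm_deriv_le_segment' hder
      (C := K * (C * (‖s‖ ^ 2 * r) ^ N * (1 + ‖s‖ ^ 2 * r) ^ (K + 1 + N)) * ‖s‖ ^ 2) ?_ r
      ⟨hr, le_rfl⟩
    · have h0 : binomRem (N + 1) c (s ^ 2 * (0 : ℝ)) = 0 := by
        simp [binomRem, Finset.sum_range_succ', binomCoeff]
      rw [h0, sub_zero] at hmv
      refine hmv.trans (le_of_eq ?_)
      rw [show K + (N + 1) = K + 1 + N by ring]
      ring
    · intro x hx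
      have hxr : x ≤ r := hx.2.le
      have hx0 : 0 ≤ x := hx.1
      rw [norm_mul, norm_mul, norm_pow]
      gcongr
      exact (h _ hc1 s hs0 hs x hx.1).trans (by gcongr)

/-! ### The Laplace integral: convergence and holomorphy -/

/-- The integrand of `laplaceInt`. -/
noncomputable def laplaceIntegrand (a c p s : ℂ) (r : ℝ) : ℂ :=
  cexp (-(p * r)) * (r : ℂ) ^ (a - 1) * (1 + s ^ 2 * r) ^ c

/-- The Laplace integral `∫₀^∞ e^{-pr} r^{a-1} (1 + s² r)^c dr`. -/
noncomputable def laplaceInt (a c p s : ℂ) : ℂ :=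
  ∫ r in Ioi (0 : ℝ), laplaceIntegrand a c p s r

theorem continuousOn_laplaceIntegrand (a c p : ℂ) {s : ℂ} (hs : 0 < s.re) :
    ContinuousOn (laplaceIntegrand a c p s) (Ioi 0) := by
  unfold laplaceIntegrand
  intro r hr
  have h1 : (r : ℂ) ∈ slitPlane := by simpa using hr
  have h2 := one_add_sq_mul_mem_slitPlane hs (le_of_lt hr)
  refine ContinuousAt.continuousWithinAt ?_
  refine (ContinuousAt.mul (by fun_prop) ?_).mul ?_
  · exact continuous_ofReal.continuousAt.cpow continuousAt_const h1
  · exact ContinuousAt.cpow (by fun_prop) continuousAt_const h2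

theorem norm_laplaceIntegrand_eq (a c p s : ℂ) {r : ℝ} (hr : 0 < r) :
    ‖laplaceIntegrand a c p s r‖ =
      Real.exp (-(p.re * r)) * r ^ (a.re - 1) * ‖(1 + s ^ 2 * r) ^ c‖ := by
  rw [laplaceIntegrand, norm_mul, norm_mul, norm_exp, norm_cpow_eq_rpow_re_of_pos hr]
  simp

/-- Half of the decay e^{-ηr} absorbs the growth of (1+s²r)^c. The constant does not depend on a, p,
s or c within the given ranges, so the right-hand side serves as a dominating function. -/
theorem exists_norm_laplaceIntegrand_le {η σ S : ℝ} (hη : 0 < η) (hσ : 0 < σ) (hσ1 : σ ≤ 1)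
    (hS : 0 < S) (K : ℕ) :
    ∃ C : ℝ, 0 ≤ C ∧ ∀ a c p s : ℂ, ‖c‖ ≤ K → η ≤ p.re → ‖s‖ ≤ S → σ * ‖s‖ ≤ s.re → ∀ r : ℝ,
      0 < r → ‖laplaceIntegrand a c p s r‖ ≤ C * (r ^ (a.re - 1) * Real.exp (-(η / 2 * r))) := by
  refine ⟨(Real.exp Real.pi / σ) ^ K * ((S ^ 2 / (η / 2)) ^ K * K.factorial *
    Real.exp (η / 2 / S ^ 2)), by positivity, fun a c p s hc hp hsS hs r hr => ?_⟩
  rw [norm_laplaceIntegrand_eq a c p s hr]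
  have h1 := norm_one_add_sq_mul_cpow_le hσ hσ1 hs hc hr.le
  have h2 : (1 + ‖s‖ ^ 2 * r) ^ K ≤ (1 + S ^ 2 * r) ^ K := by gcongr
  have h3 := one_add_mul_pow_le_exp (B := S ^ 2) (τ := η / 2) (by positivity) (by positivity)
    hr.le K
  have h4 : Real.exp (-(p.re * r)) ≤ Real.exp (-(η / 2 * r)) * Real.exp (-(η / 2 * r)) := by
    rw [← Real.exp_add, Real.exp_le_exp]
    nlinarith
  have h5 : Real.exp (-(η / 2 * r)) * Real.exp (η / 2 * r) = 1 := by
    rw [← Real.exp_add]; simp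
  set X := (S ^ 2 / (η / 2)) ^ K * (K.factorial : ℝ) * Real.exp (η / 2 / S ^ 2)
  calc Real.exp (-(p.re * r)) * r ^ (a.re - 1) * ‖(1 + s ^ 2 * r) ^ c‖
      ≤ (Real.exp (-(η / 2 * r)) * Real.exp (-(η / 2 * r))) * r ^ (a.re - 1) *
        ((Real.exp Real.pi / σ) ^ K * (X * Real.exp (η / 2 * r))) := by
        gcongr
        exact h1.trans (by gcongr; exact h2.trans h3)
    _ = (Real.exp (-(η / 2 * r)) * Real.exp (η / 2 * r)) * ((Real.exp Real.pi / σ) ^ K * X *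
        (r ^ (a.re - 1) * Real.exp (-(η / 2 * r)))) := by ring
    _ = _ := by rw [h5, one_mul]

theorem integrableOn_rpow_mul_exp_neg_mul {x η : ℝ} (hx : 0 < x) (hη : 0 < η) :
    IntegrableOn (fun r : ℝ => r ^ (x - 1) * Real.exp (-(η * r))) (Ioi 0) := by
  have h := integrableOn_rpow_mul_exp_neg_mul_rpow (p := 1) (s := x - 1) (b := η) (by linarith)
    one_pos hη
  simpa using h

theorem exists_pos_mul_norm_lt_re {s : ℂ} (hs : 0 < s.re) :
    ∃ σ : ℝ, 0 < σ ∧ σ ≤ 1 ∧ σ * ‖s‖ < s.re := by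
  have h : 0 < ‖s‖ := hs.trans_le (re_le_norm s)
  refine ⟨s.re / ‖s‖ / 2, by positivity, ?_, ?_⟩
  · have : s.re / ‖s‖ ≤ 1 := by rw [div_le_one h]; exact re_le_norm s
    linarith
  · field_simp
    linarith

theorem integrableOn_laplaceIntegrand {a c p s : ℂ} (ha : 0 < a.re) (hp : 0 < p.re)
    (hs : 0 < s.re) : IntegrableOn (laplaceIntegrand a c p s) (Ioi 0) := by
  obtain ⟨σ, hσ, hσ1, hsσ⟩ := exists_pos_mul_norm_lt_re hs
  obtain ⟨K, hK⟩ := exists_nat_ge ‖c‖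
  obtain ⟨C, -, h⟩ := exists_norm_laplaceIntegrand_le hp hσ hσ1
    (hs.trans_le (re_le_norm s)) K
  refine Integrable.mono' ((integrableOn_rpow_mul_exp_neg_mul ha (half_pos hp)).const_mul C)
    ((continuousOn_laplaceIntegrand a c p hs).aestronglyMeasurable measurableSet_Ioi) ?_
  filter_upwards [ae_restrict_mem measurableSet_Ioi] with r hr
  exact h a c p s hK le_rfl le_rfl hsσ.le r hr

/-- The conditions behind the uniform majorant are strict at ζ₀, hence hold on a ball around it. The
exponent a stays fixed because every later continuation varies only c, p and s. -/
theorem hasDerivAt_laplaceInt {a : ℂ} (ha : 0 < a.re) {c p s : ℂ → ℂ} (hc : Differentiable ℂ c)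
    (hp : Differentiable ℂ p) (hs : Differentiable ℂ s) {ζ₀ : ℂ} (hp₀ : 0 < (p ζ₀).re)
    (hs₀ : 0 < (s ζ₀).re) :
    HasDerivAt (fun ζ => laplaceInt a (c ζ) (p ζ) (s ζ))
      (∫ r in Ioi (0 : ℝ), deriv (fun ζ => laplaceIntegrand a (c ζ) (p ζ) (s ζ) r) ζ₀) ζ₀ := by
  obtain ⟨σ, hσ, hσ1, hsσ⟩ := exists_pos_mul_norm_lt_re hs₀
  obtain ⟨K, hK⟩ := exists_nat_gt ‖c ζ₀‖
  have hcc := hc.continuous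
  have hpc := hp.continuous
  have hsc := hs.continuous
  have hnhds : ∀ᶠ ζ in 𝓝 ζ₀, ‖c ζ‖ < K ∧ (p ζ₀).re / 2 < (p ζ).re ∧ ‖s ζ‖ < ‖s ζ₀‖ + 1 ∧
      σ * ‖s ζ‖ < (s ζ).re ∧ 0 < (s ζ).re := by
    refine Filter.Eventually.and ?_ (.and ?_ (.and ?_ (.and ?_ ?_)))
    · exact (hcc.norm.tendsto ζ₀).eventually_lt_const hK
    · exact ((continuous_re.comp hpc).tendsto ζ₀).eventually_const_lt (half_lt_self hp₀)
    · exact (hsc.norm.tendsto ζ₀).eventually_lt_const (lt_add_one _)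
    · exact ((hsc.norm.const_mul σ).tendsto ζ₀).eventually_lt
        ((continuous_re.comp hsc).tendsto ζ₀) hsσ
    · exact ((continuous_re.comp hsc).tendsto ζ₀).eventually_const_lt hs₀
  obtain ⟨ε, hε, hball⟩ := Metric.eventually_nhds_iff_ball.1 hnhds
  obtain ⟨C, -, h⟩ := exists_norm_laplaceIntegrand_le (half_pos hp₀) hσ hσ1
    (show 0 < ‖s ζ₀‖ + 1 by positivity) K
  have hdiff : ∀ r : ℝ, 0 < r → DifferentiableOn ℂ
      (fun ζ => laplaceIntegrand a (c ζ) (p ζ) (s ζ) r) (Metric.ball ζ₀ ε) := by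
    intro r hr ζ hζ
    have h2 := one_add_sq_mul_mem_slitPlane (hball ζ hζ).2.2.2.2 hr.le
    unfold laplaceIntegrand
    refine DifferentiableAt.differentiableWithinAt ?_
    refine (DifferentiableAt.mul (by fun_prop) (by fun_prop)).mul ?_
    exact DifferentiableAt.cpow (by fun_prop) (by fun_prop) h2
  refine hasDerivAt_integral_of_differentiableOn hε
    (bound := fun r => C * (r ^ (a.re - 1) * Real.exp (-((p ζ₀).re / 2 / 2 * r)))) ?_ ?_ ?_ ?_ ?_
  · intro ζ hζ
    exact (continuousOn_laplaceIntegrand _ _ _ (hball ζ hζ).2.2.2.2).aestronglyMeasurable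
      measurableSet_Ioi
  · filter_upwards [ae_restrict_mem measurableSet_Ioi] with r hr using hdiff r hr
  · filter_upwards [ae_restrict_mem measurableSet_Ioi] with r hr
    exact ((hdiff r hr).differentiableAt (Metric.ball_mem_nhds _ hε)).hasDerivAt
  · filter_upwards [ae_restrict_mem measurableSet_Ioi] with r hr ζ hζ
    obtain ⟨h1, h2, h3, h4, -⟩ := hball ζ hζ
    exact h a _ _ _ h1.le h2.le h3.le h4.le r hr
  · exact (integrableOn_rpow_mul_exp_neg_mul ha (by positivity)).const_mul C

theorem hasDerivAt_laplaceInt_left {a c p s : ℂ} (ha : 0 < a.re) (hp : 0 < p.re) (hs : 0 < s.re) :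
    HasDerivAt (fun p => laplaceInt a c p s) (-laplaceInt (a + 1) c p s) p := by
  have h := hasDerivAt_laplaceInt ha (c := fun _ => c) (p := fun p => p) (s := fun _ => s)
    (by fun_prop) (by fun_prop) (by fun_prop) hp hs
  refine h.congr_deriv ?_
  rw [laplaceInt, ← integral_neg]
  refine setIntegral_congr_fun measurableSet_Ioi fun r hr => ?_
  have hr0 : (r : ℂ) ≠ 0 := by exact_mod_cast (ne_of_gt hr)
  have h1 : HasDerivAt (fun p : ℂ => cexp (-(p * r))) (cexp (-(p * r)) * -(1 * r)) p :=
    ((hasDerivAt_id p).mul_const (r : ℂ)).neg.cexp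
  have h2 := (h1.mul_const ((r : ℂ) ^ (a - 1))).mul_const ((1 + s ^ 2 * r) ^ c)
  simp only [laplaceIntegrand]
  rw [h2.deriv, show a + 1 - 1 = (a - 1) + 1 by ring, cpow_add _ _ hr0, cpow_one]
  ring

/-! ### The regularised Kummer function -/

/-- The coefficients of the regularised Kummer function. -/
noncomputable def kummerCoeff (a b : ℂ) (n : ℕ) : ℂ :=
  (ascPochhammer ℂ n).eval a / n.factorial * (Gamma (b + n))⁻¹

/-- The regularised Kummer function `M(a, b, z) / Γ(b)`. -/
noncomputable def kummerReg (a b z : ℂ) : ℂ :=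
  regularizedHGFun {a} {b} z

theorem hasSum_kummerReg (a b z : ℂ) :
    HasSum (fun n : ℕ => kummerCoeff a b n * z ^ n) (kummerReg a b z) := by
  have h := radius_regularizedHGFunSeries_eq_top (a := {a}) (b := {b}) (by simp)
  have h' := FormalMultilinearSeries.hasSum (regularizedHGFunSeries {a} {b}) (x := z) (by simp [h])
  have e : ∀ n, kummerCoeff a b n = regularizedHGFunCoeff {a} {b} n := fun n => by
    simp [kummerCoeff, regularizedHGFunCoeff]
    ring
  simpa [e, kummerReg, regularizedHGFun, regularizedHGFunSeries, mul_comm,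
    FormalMultilinearSeries.ofScalars] using h'

theorem kummerReg_eq_tsum (a b z : ℂ) : kummerReg a b z = ∑' n, kummerCoeff a b n * z ^ n :=
  (hasSum_kummerReg a b z).tsum_eq.symm

/-! ### Relations between the coefficients -/

/-- A common factor of neighbouring coefficients. -/
noncomputable def kummerFactor (a b : ℂ) (n : ℕ) : ℂ :=
  (ascPochhammer ℂ n).eval a / (n + 1).factorial * (Gamma (b + n + 1))⁻¹

theorem eval_ascPochhammer_succ_left (a : ℂ) (n : ℕ) :
    (ascPochhammer ℂ (n + 1)).eval a = a * (ascPochhammer ℂ n).eval (a + 1) := by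
  simp [ascPochhammer_succ_left]

theorem kummerCoeff_succ_eq (a b : ℂ) (n : ℕ) :
    kummerCoeff a b (n + 1) = (a + n) * kummerFactor a b n := by
  rw [kummerCoeff, kummerFactor, ascPochhammer_succ_eval]
  push_cast
  rw [← add_assoc]
  ring

theorem kummerCoeff_eq (a b : ℂ) (n : ℕ) :
    kummerCoeff a b n = (n + 1) * (b + n) * kummerFactor a b n := by
  have h : ((n : ℂ) + 1) ≠ 0 := by exact_mod_cast n.succ_ne_zero
  rw [kummerCoeff, kummerFactor, one_div_Gamma_eq_self_mul_one_div_Gamma_add_one,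
    Nat.factorial_succ]
  push_cast
  field_simp

theorem kummerCoeff_sub_one_left (a b : ℂ) (n : ℕ) :
    kummerCoeff (a - 1) b (n + 1) = (a - 1) * kummerFactor a b n := by
  rw [kummerCoeff, kummerFactor, eval_ascPochhammer_succ_left, sub_add_cancel]
  push_cast
  rw [← add_assoc]
  ring

theorem kummerCoeff_sub_one_right (a b : ℂ) (n : ℕ) :
    kummerCoeff a (b - 1) n = (b - 1 + n) * kummerCoeff a b n := by
  rw [kummerCoeff, kummerCoeff, one_div_Gamma_eq_self_mul_one_div_Gamma_add_one,
    show b - 1 + n + 1 = b + n by ring]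
  ring

theorem kummerCoeff_add_one_left (a b : ℂ) (n : ℕ) :
    a * kummerCoeff (a + 1) b n = (a + n) * kummerCoeff a b n := by
  have h := eval_ascPochhammer_succ_left a n
  rw [ascPochhammer_succ_eval] at h
  rw [kummerCoeff, kummerCoeff]
  linear_combination -(1 / (n.factorial : ℂ) * (Gamma (b + n))⁻¹) * h

theorem succ_mul_kummerCoeff_succ (a b : ℂ) (n : ℕ) :
    (n + 1) * kummerCoeff a b (n + 1) = a * kummerCoeff (a + 1) (b + 1) n := by
  have h : ((n : ℂ) + 1) ≠ 0 := by exact_mod_cast n.succ_ne_zero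
  rw [kummerCoeff, kummerCoeff, eval_ascPochhammer_succ_left, Nat.factorial_succ]
  push_cast
  rw [show b + ((n : ℂ) + 1) = b + 1 + n by ring]
  field_simp

theorem HasSum.mul_kummer_shift {c : ℕ → ℂ} {z S : ℂ} (h : HasSum (fun n => c n * z ^ n) S) :
    HasSum (fun n => (if n = 0 then 0 else c (n - 1)) * z ^ n) (z * S) := by
  rw [← hasSum_nat_add_iff' 1]
  simpa [pow_succ, mul_comm, mul_left_comm] using h.mul_left z

/-- Kummer's equation with a common factor a removed, checked coefficient by coefficient. -/
theorem kummerReg_ode_aux (a b z : ℂ) :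
    z * ((a + 1) * kummerReg (a + 2) (b + 2) z) + b * kummerReg (a + 1) (b + 1) z
      - z * kummerReg (a + 1) (b + 1) z - kummerReg a b z = 0 := by
  have h1 := ((hasSum_kummerReg (a + 2) (b + 2) z).mul_left (a + 1))
  simp only [← mul_assoc] at h1
  have h2 := (hasSum_kummerReg (a + 1) (b + 1) z)
  have h3 := (hasSum_kummerReg a b z)
  refine ((((HasSum.mul_kummer_shift (c := fun n => (a + 1) * kummerCoeff (a + 2) (b + 2) n)
    h1).add (h2.mul_left b)).sub
    h2.mul_kummer_shift).sub h3).unique ?_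
  convert hasSum_zero with n
  cases n with
  | zero =>
    -- The constant term is 1/Γ(b) = b/Γ(b+1), which is valid at the poles too.
    have h := kummerCoeff_sub_one_right a (b + 1) 0
    simp only [kummerCoeff, ascPochhammer_zero, Polynomial.eval_one] at h
    simp [kummerCoeff] at h ⊢
    rw [h]
    ring
  | succ n =>
    have e1 := succ_mul_kummerCoeff_succ (a + 1) (b + 1) n
    have e2 := kummerCoeff_succ_eq (a + 1) (b + 1) n
    have e3 := kummerCoeff_eq (a + 1) (b + 1) n
    have e4 := kummerCoeff_sub_one_left (a + 1) (b + 1) n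
    have e5 := kummerCoeff_sub_one_right a (b + 1) (n + 1)
    rw [add_sub_cancel_right] at e4 e5
    rw [show a + 1 + 1 = a + 2 by ring, show b + 1 + 1 = b + 2 by ring] at e1
    simp only [Nat.add_eq_zero_iff, one_ne_zero, and_false, if_false, Nat.add_sub_cancel]
    push_cast at e5
    rw [← e1, e2, e3, e5, e4]
    ring

theorem kummerReg_mul_deriv (a b z : ℂ) :
    z * (a * kummerReg (a + 1) (b + 1) z) - kummerReg a (b - 1) z + (b - 1) * kummerReg a b z
      = 0 := by
  have h1 := ((hasSum_kummerReg (a + 1) (b + 1) z).mul_left a)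
  simp only [← mul_assoc] at h1
  refine (((HasSum.mul_kummer_shift (c := fun n => a * kummerCoeff (a + 1) (b + 1) n) h1).sub
    (hasSum_kummerReg a (b - 1) z)).add ((hasSum_kummerReg a b z).mul_left (b - 1))).unique ?_
  convert hasSum_zero with n
  rw [kummerCoeff_sub_one_right]
  cases n with
  | zero => simp
  | succ n =>
    simp only [Nat.add_eq_zero_iff, one_ne_zero, and_false, if_false, Nat.add_sub_cancel]
    rw [← succ_mul_kummerCoeff_succ]
    push_cast
    ring

/-- In this form it is Kummer's equation for the second Frobenius solution, whose derivatives lower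
the second parameter. -/
theorem kummerReg_contiguous_right (a b z : ℂ) :
    kummerReg a (b - 2) z + (2 - b) * kummerReg a (b - 1) z - z * kummerReg a (b - 1) z
      - z * ((a + 1 - b) * kummerReg a b z) = 0 := by
  have h1 := ((hasSum_kummerReg a b z).mul_left (a + 1 - b))
  simp only [← mul_assoc] at h1
  have h2 := hasSum_kummerReg a (b - 1) z
  refine ((((hasSum_kummerReg a (b - 2) z).add (h2.mul_left (2 - b))).sub
    h2.mul_kummer_shift).sub (HasSum.mul_kummer_shift (c := fun n => (a + 1 - b) *
    kummerCoeff a b n) h1)).unique ?_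
  convert hasSum_zero with n
  rw [show b - 2 = b - 1 - 1 by ring, kummerCoeff_sub_one_right a (b - 1) n,
    kummerCoeff_sub_one_right]
  cases n with
  | zero => simp; ring
  | succ n =>
    simp only [Nat.add_eq_zero_iff, one_ne_zero, and_false, if_false, Nat.add_sub_cancel]
    rw [kummerCoeff_sub_one_right a b n, kummerCoeff_succ_eq, kummerCoeff_eq]
    push_cast
    ring

/-- The source of the recurrence in κ for the Whittaker functions. -/
theorem kummerReg_contiguous_left (a b z : ℂ) :
    (b - a) * kummerReg (a - 1) b z + (2 * a - b) * kummerReg a b z + z * kummerReg a b z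
      - a * kummerReg (a + 1) b z = 0 := by
  have h2 := hasSum_kummerReg a b z
  refine (((((hasSum_kummerReg (a - 1) b z).mul_left (b - a)).add (h2.mul_left (2 * a - b))).add
    h2.mul_kummer_shift).sub ((hasSum_kummerReg (a + 1) b z).mul_left a)).unique ?_
  convert hasSum_zero with n
  rw [← mul_assoc a, kummerCoeff_add_one_left]
  cases n with
  | zero => simp [kummerCoeff]; ring
  | succ n =>
    simp only [Nat.add_eq_zero_iff, one_ne_zero, and_false, if_false, Nat.add_sub_cancel]
    rw [kummerCoeff_sub_one_left, kummerCoeff_succ_eq, kummerCoeff_eq]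
    push_cast
    ring

/-! ### Holomorphy -/

theorem differentiable_kummerCoeff {a b : ℂ → ℂ} (ha : Differentiable ℂ a)
    (hb : Differentiable ℂ b) (n : ℕ) : Differentiable ℂ fun ζ => kummerCoeff (a ζ) (b ζ) n := by
  unfold kummerCoeff
  refine Differentiable.mul ?_ ?_
  · exact ((ascPochhammer ℂ n).differentiable.comp ha).div_const _
  · exact differentiable_one_div_Gamma.comp (hb.add_const _)

theorem exists_norm_kummerCoeff_le (K n : ℕ) :
    ∃ M : ℝ, ∀ a b : ℂ, ‖a‖ ≤ K → ‖b‖ ≤ K → ‖kummerCoeff a b n‖ ≤ M := by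
  have hc : Continuous fun x : ℂ × ℂ => kummerCoeff x.1 x.2 n := by
    unfold kummerCoeff
    refine Continuous.mul ?_ ?_
    · exact ((ascPochhammer ℂ n).continuous.comp continuous_fst).div_const _
    · exact differentiable_one_div_Gamma.continuous.comp (by fun_prop)
  obtain ⟨M, hM⟩ := ((isCompact_closedBall (0 : ℂ) K).prod
    (isCompact_closedBall (0 : ℂ) K)).exists_bound_of_continuousOn hc.continuousOn
  exact ⟨M, fun a b ha hb => hM (a, b) (by simpa using ⟨ha, hb⟩)⟩

/-- Consecutive terms have ratio (a+n)z / ((n+1)(b+n)), at most 1/2 in norm from n = 8K+1 on. Both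
terms are written through `kummerFactor`, so nothing is divided by. -/
theorem norm_kummerCoeff_succ_mul_pow_le {K n : ℕ} (hn : 8 * K + 1 ≤ n) {a b z : ℂ}
    (ha : ‖a‖ ≤ K) (hb : ‖b‖ ≤ K) (hz : ‖z‖ ≤ K) :
    ‖kummerCoeff a b (n + 1) * z ^ (n + 1)‖ ≤ 1 / 2 * ‖kummerCoeff a b n * z ^ n‖ := by
  have hnK : (8 * K + 1 : ℝ) ≤ n := by exact_mod_cast hn
  have hK : (0 : ℝ) ≤ K := by positivity
  rw [kummerCoeff_succ_eq, kummerCoeff_eq, pow_succ]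
  simp only [norm_mul]
  have h1 : ‖a + n‖ ≤ K + n := (norm_add_le _ _).trans (by simpa using ha)
  have h2 : (n : ℝ) - K ≤ ‖b + n‖ := by
    have := norm_sub_norm_le (n : ℂ) (-b)
    rw [sub_neg_eq_add, norm_neg, add_comm (n : ℂ) b] at this
    simp only [norm_natCast] at this
    linarith
  have h3 : ‖(n : ℂ) + 1‖ = n + 1 := by exact_mod_cast norm_natCast (n + 1)
  have h4 : ‖a + n‖ * ‖z‖ ≤ 1 / 2 * (‖(n : ℂ) + 1‖ * ‖b + n‖) := by
    rw [h3]
    calc ‖a + n‖ * ‖z‖ ≤ (K + n) * K := by gcongr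
      _ ≤ 1 / 2 * ((n + 1) * (n - K)) := by nlinarith
      _ ≤ _ := by gcongr
  calc _ = (‖a + n‖ * ‖z‖) * (‖kummerFactor a b n‖ * ‖z ^ n‖) := by ring
    _ ≤ (1 / 2 * (‖(n : ℂ) + 1‖ * ‖b + n‖)) * (‖kummerFactor a b n‖ * ‖z ^ n‖) := by gcongr
    _ = _ := by ring

/-- Finitely many terms are bounded by compactness and the tail is geometric. This majorant gives
holomorphy along any holomorphic choice of the three arguments. -/
theorem exists_summable_norm_kummerCoeff_mul_pow_le (K : ℕ) :
    ∃ u : ℕ → ℝ, Summable u ∧ ∀ n, ∀ a b z : ℂ, ‖a‖ ≤ K → ‖b‖ ≤ K → ‖z‖ ≤ K →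
      ‖kummerCoeff a b n * z ^ n‖ ≤ u n := by
  choose M hM using exists_norm_kummerCoeff_le K
  set n₀ := 8 * K + 1
  refine ⟨fun n => if n < n₀ then M n * K ^ n else M n₀ * K ^ n₀ * (1 / 2) ^ (n - n₀), ?_, ?_⟩
  · rw [← summable_nat_add_iff n₀]
    simpa using (summable_geometric_two.mul_left (M n₀ * (K : ℝ) ^ n₀))
  · intro n a b z ha hb hz
    have hb0 : ∀ n, ‖kummerCoeff a b n * z ^ n‖ ≤ M n * K ^ n := by
      intro n
      rw [norm_mul, norm_pow]
      have := hM n a b ha hb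
      have h0 : 0 ≤ M n := (norm_nonneg _).trans this
      gcongr
    dsimp only
    split_ifs with h
    · exact hb0 n
    · obtain ⟨k, rfl⟩ := Nat.exists_eq_add_of_le (not_lt.1 h)
      rw [Nat.add_sub_cancel_left]
      clear h
      induction k with
      | zero => simpa using hb0 n₀
      | succ k ih =>
        refine (norm_kummerCoeff_succ_mul_pow_le (n := n₀ + k) (by omega) ha hb hz).trans ?_
        rw [pow_succ (1 / 2 : ℝ) k]
        linarith

theorem differentiable_kummerReg {a b z : ℂ → ℂ} (ha : Differentiable ℂ a)
    (hb : Differentiable ℂ b) (hz : Differentiable ℂ z) :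
    Differentiable ℂ fun ζ => kummerReg (a ζ) (b ζ) (z ζ) := by
  intro ζ₀
  obtain ⟨K, hK⟩ := exists_nat_gt (‖a ζ₀‖ + ‖b ζ₀‖ + ‖z ζ₀‖)
  have hU : IsOpen {ζ | ‖a ζ‖ + ‖b ζ‖ + ‖z ζ‖ < K} :=
    isOpen_lt ((ha.continuous.norm.add hb.continuous.norm).add hz.continuous.norm)
      continuous_const
  obtain ⟨u, hu, hle⟩ := exists_summable_norm_kummerCoeff_mul_pow_le K
  simp only [kummerReg_eq_tsum]
  refine (differentiableOn_tsum_of_summable_norm hu (fun n => ?_) hU fun n ζ hζ => ?_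
    ).differentiableAt (hU.mem_nhds hK)
  · exact ((differentiable_kummerCoeff ha hb n).mul (hz.pow n)).differentiableOn
  · have h1 := norm_nonneg (a ζ)
    have h2 := norm_nonneg (b ζ)
    have h3 := norm_nonneg (z ζ)
    simp only [Set.mem_ofPred_eq] at hζ
    exact hle n _ _ _ (by linarith) (by linarith) (by linarith)

theorem hasDerivAt_kummerReg (a b z : ℂ) :
    HasDerivAt (kummerReg a b) (a * kummerReg (a + 1) (b + 1) z) z := by
  have hd : Differentiable ℂ (kummerReg a b) :=
    differentiable_kummerReg (differentiable_const a) (differentiable_const b) differentiable_id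
  refine (hd z).hasDerivAt.congr_deriv ?_
  obtain ⟨K, hK⟩ := exists_nat_gt (‖a‖ + ‖b‖ + ‖z‖)
  have h1 := norm_nonneg a
  have h2 := norm_nonneg b
  have h3 := norm_nonneg z
  obtain ⟨u, hu, hle⟩ := exists_summable_norm_kummerCoeff_mul_pow_le K
  have h := hasSum_deriv_of_summable_norm (F := fun n z => kummerCoeff a b n * z ^ n) hu
    (fun n => by fun_prop) (Metric.isOpen_ball (x := (0 : ℂ)) (ε := K))
    (fun n w hw => hle n a b w (by linarith) (by linarith)
      (by simpa using (mem_ball_zero_iff.1 hw).le)) (z := z) (by simp; linarith)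
  rw [show (fun w => ∑' n, kummerCoeff a b n * w ^ n) = kummerReg a b from
    funext fun w => (kummerReg_eq_tsum a b w).symm] at h
  refine h.unique ?_
  rw [← hasSum_nat_add_iff' 1]
  have e : (fun n => deriv (fun w => kummerCoeff a b (n + 1) * w ^ (n + 1)) z) =
      fun n => a * (kummerCoeff (a + 1) (b + 1) n * z ^ n) := by
    ext n
    rw [← mul_assoc, ← succ_mul_kummerCoeff_succ]
    simp
    ring
  rw [e]
  simpa using (hasSum_kummerReg (a + 1) (b + 1) z).mul_left a

/-! ### The Laplace integral: differential equation, scaling, behaviour as z → 0 -/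

theorem laplaceIntegrand_add_one_left (a c p s : ℂ) {r : ℝ} (hr : 0 < r) :
    laplaceIntegrand (a + 1) c p s r = r * laplaceIntegrand a c p s r := by
  have hr0 : (r : ℂ) ≠ 0 := by exact_mod_cast hr.ne'
  rw [laplaceIntegrand, laplaceIntegrand, show a + 1 - 1 = (a - 1) + 1 by ring, cpow_add _ _ hr0,
    cpow_one]
  ring

/-- The combined integrand is minus the derivative of e^{-pr} r^a (1+r)^{c+1}, which vanishes at 0
and at ∞. Since differentiation in p raises a by one up to sign, this is Kummer's equation with b =
a+c+1. -/
theorem laplaceInt_ode {a c p : ℂ} (ha : 0 < a.re) (hp : 0 < p.re) :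
    p * laplaceInt (a + 2) c p 1 - (a + c + 1 - p) * laplaceInt (a + 1) c p 1
      - a * laplaceInt a c p 1 = 0 := by
  have h1 : 0 < (1 : ℂ).re := by simp
  have ha1 : 0 < (a + 1).re := by simp; linarith
  have ha2 : 0 < (a + 2).re := by simp; linarith
  have i0 := integrableOn_laplaceIntegrand (c := c) ha hp h1
  have i1 := integrableOn_laplaceIntegrand (c := c) ha1 hp h1
  have i2 := integrableOn_laplaceIntegrand (c := c) ha2 hp h1
  set g : ℝ → ℂ := fun r => p * laplaceIntegrand (a + 2) c p 1 r -
    (a + c + 1 - p) * laplaceIntegrand (a + 1) c p 1 r - a * laplaceIntegrand a c p 1 r with hg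
  have ig : IntegrableOn g (Ioi 0) :=
    ((i2.const_mul p).sub (i1.const_mul (a + c + 1 - p))).sub (i0.const_mul a)
  have iF := integrableOn_laplaceIntegrand (c := c + 1) ha1 hp h1
  have hder : ∀ r ∈ Ioi (0 : ℝ), HasDerivAt (laplaceIntegrand (a + 1) (c + 1) p 1) (-g r) r := by
    intro r hr
    have hr0 : (r : ℂ) ≠ 0 := by exact_mod_cast (ne_of_gt hr)
    have hsl := one_add_sq_mul_mem_slitPlane h1 (le_of_lt hr)
    have d1 : HasDerivAt (fun r : ℂ => cexp (-(p * r))) (cexp (-(p * r)) * -(p * 1)) r :=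
      ((hasDerivAt_id (r : ℂ)).const_mul p).neg.cexp
    have d2 : HasDerivAt (fun r : ℂ => r ^ (a + 1 - 1)) ((a + 1 - 1) * (r : ℂ) ^ (a + 1 - 1 - 1) * 1)
        r := (hasDerivAt_id (r : ℂ)).cpow_const (by simpa using hr)
    have d3 : HasDerivAt (fun r : ℂ => (1 + (1 : ℂ) ^ 2 * r) ^ (c + 1))
        ((c + 1) * (1 + (1 : ℂ) ^ 2 * r) ^ (c + 1 - 1) * ((1 : ℂ) ^ 2 * 1)) r :=
      (((hasDerivAt_id (r : ℂ)).const_mul ((1 : ℂ) ^ 2)).const_add 1).cpow_const hsl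
    refine ((d1.mul d2).mul d3).comp_ofReal.congr_deriv ?_
    have e1 := laplaceIntegrand_add_one_left a c p 1 hr
    have e2 := laplaceIntegrand_add_one_left (a + 1) c p 1 hr
    rw [show a + 1 + 1 = a + 2 by ring] at e2
    simp only [hg, e2, e1]
    simp only [laplaceIntegrand, Pi.mul_apply]
    have hX := slitPlane_ne_zero hsl
    rw [cpow_add _ _ hX, show a + 1 - 1 = (a - 1) + 1 by ring, cpow_add _ _ hr0]
    simp only [cpow_one, add_sub_cancel_right, one_pow, one_mul, mul_one]
    ring
  have hcont : ContinuousWithinAt (laplaceIntegrand (a + 1) (c + 1) p 1) (Ici 0) 0 := by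
    refine ContinuousAt.continuousWithinAt ?_
    unfold laplaceIntegrand
    refine (ContinuousAt.mul (by fun_prop) ?_).mul ?_
    · exact (continuousAt_ofReal_cpow 0 (a + 1 - 1) (by left; simpa using ha)).comp
        (f := fun r : ℝ => (r, a + 1 - 1)) (by fun_prop)
    · exact ContinuousAt.cpow (by fun_prop) continuousAt_const (by simp)
  -- The boundary term at infinity vanishes because the function and its derivative are both
  -- integrable.
  have h := integral_Ioi_of_hasDerivAt_of_tendsto hcont hder ig.neg
    (tendsto_zero_of_hasDerivAt_of_integrableOn_Ioi hder ig.neg iF)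
  have h0 : laplaceIntegrand (a + 1) (c + 1) p 1 0 = 0 := by
    have : a ≠ 0 := by rintro rfl; simp at ha
    simp [laplaceIntegrand, zero_cpow this]
  rw [h0, sub_zero, integral_neg, neg_eq_zero, hg, integral_sub, integral_sub,
    integral_const_mul, integral_const_mul, integral_const_mul] at h
  · exact h
  · exact i2.const_mul p
  · exact i1.const_mul _
  · exact (i2.const_mul p).sub (i1.const_mul _)
  · exact i0.const_mul a

/-- Substitution r ↦ e^{2y} r. As y is real, the path of integration stays on the positive axis. -/
theorem laplaceInt_scale (a c p s : ℂ) (y : ℝ) :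
    laplaceInt a c p s = cexp (2 * y * a) * laplaceInt a c (p * cexp (2 * y)) (s * cexp y) := by
  have hl : 0 < Real.exp (2 * y) := Real.exp_pos _
  have h := integral_comp_mul_left_Ioi (laplaceIntegrand a c p s) 0 hl
  rw [mul_zero, eq_inv_smul_iff₀ hl.ne'] at h
  rw [laplaceInt, ← h, laplaceInt, ← integral_const_mul, ← integral_smul]
  refine setIntegral_congr_fun measurableSet_Ioi fun r hr => ?_
  have hsq : cexp (2 * y) = cexp y ^ 2 := by rw [← Complex.exp_nat_mul]; norm_num
  have hpow : cexp (2 * y) ^ (a - 1) * cexp (2 * y) = cexp (2 * y * a) := by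
    rw [cpow_def_of_ne_zero (exp_ne_zero _), show cexp (2 * y) = ((Real.exp (2 * y) : ℝ) : ℂ) by
      push_cast; rfl, ← ofReal_log hl.le, Real.log_exp]
    push_cast
    rw [← Complex.exp_add]
    ring_nf
  simp only [laplaceIntegrand, real_smul, ofReal_mul, ofReal_exp]
  have e := mul_cpow_ofReal_nonneg hl.le (le_of_lt hr) (a - 1)
  push_cast at e ⊢
  rw [e, ← hpow, mul_pow, ← hsq, ← mul_assoc p, ← mul_assoc (s ^ 2)]
  ring

theorem ofReal_cpow_eq_exp {y : ℝ} (hy : 0 < y) (s : ℂ) :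
    (y : ℂ) ^ s = cexp (Real.log y * s) := by
  rw [cpow_def_of_ne_zero (by exact_mod_cast hy.ne'), ofReal_log hy.le]

/-- Euler's beta integral over the half line. -/
theorem integral_cpow_mul_one_add_cpow {a d : ℂ} (ha : 0 < a.re) (hd : 0 < d.re) :
    IntegrableOn (fun t : ℝ => (t : ℂ) ^ (a - 1) * (1 + t : ℂ) ^ (-(a + d))) (Ioi 0) ∧
      ∫ t in Ioi (0 : ℝ), (t : ℂ) ^ (a - 1) * (1 + t : ℂ) ^ (-(a + d)) = betaIntegral a d := by
  have himg : (fun x : ℝ => x / (1 - x)) '' Ioo 0 1 = Ioi 0 := by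
    ext t
    constructor
    · rintro ⟨x, hx, rfl⟩
      exact div_pos hx.1 (sub_pos.2 hx.2)
    · intro ht
      have ht : 0 < t := ht
      refine ⟨t / (1 + t), ⟨by positivity, ?_⟩, ?_⟩
      · rw [div_lt_one (by positivity)]; linarith
      · field_simp; ring
  have hder : ∀ x ∈ Ioo (0 : ℝ) 1,
      HasDerivWithinAt (fun x : ℝ => x / (1 - x)) (1 / (1 - x) ^ 2) (Ioo 0 1) x := by
    intro x hx
    have h : (1 - x) ≠ 0 := by linarith [hx.2]
    have h1 := (hasDerivAt_id x).div ((hasDerivAt_id x).const_sub 1) h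
    refine (h1.congr_deriv ?_).hasDerivWithinAt
    simp
  have hinj : InjOn (fun x : ℝ => x / (1 - x)) (Ioo 0 1) := by
    intro x hx y hy hxy
    have h1 : (1 - x) ≠ 0 := by linarith [hx.2]
    have h2 : (1 - y) ≠ 0 := by linarith [hy.2]
    simp only at hxy
    field_simp at hxy
    linarith
  have hpt : ∀ x ∈ Ioo (0 : ℝ) 1, |1 / (1 - x) ^ 2| •
      (((x / (1 - x) : ℝ) : ℂ) ^ (a - 1) * (1 + ((x / (1 - x) : ℝ) : ℂ)) ^ (-(a + d))) =
      (x : ℂ) ^ (a - 1) * (1 - (x : ℂ)) ^ (d - 1) := by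
    intro x hx
    have hx0 := hx.1
    have hx1 : 0 < 1 - x := by linarith [hx.2]
    have e1 : (1 + ((x / (1 - x) : ℝ) : ℂ)) = ((1 / (1 - x) : ℝ) : ℂ) := by
      have : (1 - (x : ℂ)) ≠ 0 := by exact_mod_cast hx1.ne'
      push_cast
      field_simp
      ring
    have e2 : (1 - (x : ℂ)) = ((1 - x : ℝ) : ℂ) := by push_cast; ring
    have e3 : ((1 / (1 - x) ^ 2 : ℝ) : ℂ) = cexp (Real.log (1 - x) * (-2)) := by
      rw [← ofReal_cpow_eq_exp hx1, cpow_neg]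
      push_cast
      rw [one_div]
      norm_cast
    rw [abs_of_pos (by positivity), real_smul, e1, e2, e3, ofReal_cpow_eq_exp (by positivity),
      ofReal_cpow_eq_exp (by positivity), ofReal_cpow_eq_exp hx0, ofReal_cpow_eq_exp hx1,
      Real.log_div hx0.ne' hx1.ne', one_div, Real.log_inv, ← Complex.exp_add, ← Complex.exp_add,
      ← Complex.exp_add]
    congr 1
    push_cast
    ring
  rw [← himg, integrableOn_image_iff_integrableOn_abs_deriv_smul measurableSet_Ioo hder hinj,
    integral_image_eq_integral_abs_deriv_smul measurableSet_Ioo hder hinj,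
    setIntegral_congr_fun measurableSet_Ioo hpt, integrableOn_congr_fun hpt measurableSet_Ioo,
    betaIntegral, intervalIntegral.integral_of_le zero_le_one, integral_Ioc_eq_integral_Ioo]
  refine ⟨?_, rfl⟩
  have h := (betaIntegral_convergent ha hd).1
  exact h.mono_set Ioo_subset_Ioc_self

theorem tendsto_cexp_ofReal_atBot : Tendsto (fun x : ℝ => cexp x) atBot (𝓝 0) := by
  rw [tendsto_zero_iff_norm_tendsto_zero]
  simpa [norm_exp] using Real.tendsto_exp_atBot

theorem tendsto_cexp_mul_ofReal_atBot {b : ℂ} (hb : 0 < b.re) :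
    Tendsto (fun x : ℝ => cexp (b * x)) atBot (𝓝 0) := by
  rw [tendsto_zero_iff_norm_tendsto_zero]
  simp only [norm_exp, mul_re, ofReal_re, ofReal_im, mul_zero, sub_zero]
  exact Real.tendsto_exp_atBot.comp (tendsto_id.const_mul_atBot hb)

theorem tendsto_laplaceInt_atBot {a d : ℂ} (ha : 0 < a.re) (hd : 0 < d.re) :
    Tendsto (fun x : ℝ => laplaceInt a (-(a + d)) (cexp x) 1) atBot (𝓝 (betaIntegral a d)) := by
  obtain ⟨hint, hval⟩ := integral_cpow_mul_one_add_cpow ha hd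
  rw [← hval]
  refine tendsto_integral_filter_of_dominated_convergence _ (.of_forall fun x => ?_)
    (.of_forall fun x => ?_) hint.norm ?_
  · exact (continuousOn_laplaceIntegrand _ _ _ (by simp)).aestronglyMeasurable measurableSet_Ioi
  · filter_upwards [ae_restrict_mem measurableSet_Ioi] with r hr
    have hr : 0 < r := hr
    have h : ‖cexp (-(cexp x * r))‖ ≤ 1 := by
      rw [norm_exp, Real.exp_le_one_iff, ← ofReal_exp, ← ofReal_mul, ← ofReal_neg, ofReal_re]
      have := Real.exp_pos x
      simp only [Left.neg_nonpos_iff]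
      positivity
    rw [laplaceIntegrand, mul_assoc, norm_mul, one_pow, one_mul]
    exact mul_le_of_le_one_left (norm_nonneg _) h
  · filter_upwards [ae_restrict_mem measurableSet_Ioi] with r hr
    have h : Tendsto (fun x : ℝ => cexp (-(cexp x * r))) atBot (𝓝 1) := by
      have h1 := (tendsto_cexp_ofReal_atBot.mul_const (r : ℂ)).neg
      have h2 := (Complex.continuous_exp.tendsto _).comp h1
      simpa [Function.comp_def] using h2
    have h3 := h.mul_const ((r : ℂ) ^ (a - 1) * (1 + (r : ℂ)) ^ (-(a + d)))
    simpa [laplaceIntegrand, mul_assoc] using h3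

/-- Substituting r ↦ r/z moves the singularity at z = 0 into the factor (z+r)^c, where dominated
convergence can handle it. -/
theorem cexp_mul_laplaceInt_eq (a c : ℂ) (x : ℝ) :
    cexp ((a + c) * x) * laplaceInt a c (cexp x) 1 =
      ∫ r in Ioi (0 : ℝ), cexp (-r) * (r : ℂ) ^ (a - 1) * (cexp x + r) ^ c := by
  rw [laplaceInt_scale a c (cexp x) 1 (-x / 2), ← mul_assoc, laplaceInt, ← integral_const_mul]
  refine setIntegral_congr_fun measurableSet_Ioi fun r hr => ?_
  have hr : 0 < r := hr
  simp only [laplaceIntegrand]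
  have e1 : cexp x * cexp (2 * ((-x / 2 : ℝ) : ℂ)) = 1 := by
    rw [← Complex.exp_add]
    push_cast
    ring_nf
    simp
  have e2 : (1 * cexp ((-x / 2 : ℝ) : ℂ)) ^ 2 = ((Real.exp (-x) : ℝ) : ℂ) := by
    rw [one_mul, ← Complex.exp_nat_mul]
    push_cast
    ring_nf
  have e3 : cexp x + r = ((Real.exp x * (1 + Real.exp (-x) * r) : ℝ) : ℂ) := by
    have : Real.exp x * (1 + Real.exp (-x) * r) = Real.exp x + r := by
      rw [mul_add, ← mul_assoc, ← Real.exp_add]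
      simp
    rw [this]
    push_cast
    rfl
  have e4 : (1 + ((Real.exp (-x) : ℝ) : ℂ) * r) = ((1 + Real.exp (-x) * r : ℝ) : ℂ) := by
    push_cast
    rfl
  have hpos : 0 < 1 + Real.exp (-x) * r := by positivity
  have e5 : (((Real.exp x * (1 + Real.exp (-x) * r) : ℝ) : ℂ)) ^ c =
      cexp (c * x) * ((1 + Real.exp (-x) * r : ℝ) : ℂ) ^ c := by
    rw [ofReal_mul, mul_cpow_ofReal_nonneg (Real.exp_pos x).le hpos.le,
      ofReal_cpow_eq_exp (Real.exp_pos x), Real.log_exp, mul_comm (x : ℂ)]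
  have e6 : cexp ((a + c) * x) * cexp (2 * ((-x / 2 : ℝ) : ℂ) * a) = cexp (c * x) := by
    rw [← Complex.exp_add]
    push_cast
    ring_nf
  rw [e1, e2, e3, e4, e5, e6, one_mul]
  ring

/-- Re c ≤ 0 gives |(z+r)^c| ≤ r^{Re c}, so the integrand of Γ(a+c) dominates. It is applied to the
derivative of the Laplace integral, hence with a+1 for a. -/
theorem tendsto_cexp_mul_laplaceInt_atBot {a c : ℂ} (hac : 0 < (a + c).re) (hc : c.re ≤ 0) :
    Tendsto (fun x : ℝ => cexp ((a + c) * x) * laplaceInt a c (cexp x) 1) atBot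
      (𝓝 (Gamma (a + c))) := by
  simp only [cexp_mul_laplaceInt_eq]
  rw [Gamma_eq_integral hac, GammaIntegral]
  have hx : ∀ x : ℝ, ∀ r : ℝ, cexp x + r = ((Real.exp x + r : ℝ) : ℂ) := fun x r => by
    push_cast
    rfl
  refine tendsto_integral_filter_of_dominated_convergence
    (fun r => Real.exp (-r) * r ^ ((a + c).re - 1))
    (.of_forall fun x => ContinuousOn.aestronglyMeasurable (fun r hr => ?_) measurableSet_Ioi)
    (.of_forall fun x => ?_) (Real.GammaIntegral_convergent hac) ?_
  · have hr : 0 < r := hr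
    refine ContinuousAt.continuousWithinAt ?_
    refine (ContinuousAt.mul (by fun_prop) ?_).mul ?_
    · exact continuous_ofReal.continuousAt.cpow continuousAt_const (by simpa using hr)
    · refine ContinuousAt.cpow (by fun_prop) continuousAt_const ?_
      rw [hx, ofReal_mem_slitPlane]
      positivity
  · filter_upwards [ae_restrict_mem measurableSet_Ioi] with r hr
    have hr : 0 < r := hr
    rw [norm_mul, norm_mul, hx, norm_cpow_eq_rpow_re_of_pos hr,
      norm_cpow_eq_rpow_re_of_pos (by positivity), norm_exp, mul_assoc]
    simp only [neg_re, ofReal_re]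
    gcongr
    calc r ^ (a - 1).re * (Real.exp x + r) ^ c.re ≤ r ^ (a - 1).re * r ^ c.re := by
          gcongr ?_ * ?_
          exact Real.rpow_le_rpow_of_nonpos hr (by linarith [Real.exp_pos x]) hc
      _ = r ^ ((a + c).re - 1) := by
        rw [← Real.rpow_add hr]
        simp
        ring_nf
  · filter_upwards [ae_restrict_mem measurableSet_Ioi] with r hr
    have hr : 0 < r := hr
    have hr0 : (r : ℂ) ≠ 0 := by exact_mod_cast hr.ne'
    have h1 : Tendsto (fun x : ℝ => cexp x + r) atBot (𝓝 (r : ℂ)) := by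
      simpa using tendsto_cexp_ofReal_atBot.add_const (r : ℂ)
    have h2 : ContinuousAt (fun u : ℂ => u ^ c) (r : ℂ) :=
      continuousAt_id.cpow continuousAt_const (by simpa using hr)
    have h3 := (h2.tendsto.comp h1).const_mul (cexp (-r) * (r : ℂ) ^ (a - 1))
    refine (h3.congr' (.of_forall fun x => rfl)).trans (le_of_eq ?_)
    rw [mul_assoc, ← cpow_add _ _ hr0, ofReal_exp, ofReal_neg]
    ring_nf

/-! ### Kummer's equation, Wronskians and the connection formula -/

/-- `f` solves Kummer's equation `z f'' + (b - z) f' = a f` on the positive reals `z = eˣ`, with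
derivatives `f'` and `f''` with respect to `z`. -/
structure IsKummerSolution (a b : ℂ) (f f' f'' : ℝ → ℂ) : Prop where
  hasDerivAt : ∀ x : ℝ, HasDerivAt f (cexp x * f' x) x
  hasDerivAt' : ∀ x : ℝ, HasDerivAt f' (cexp x * f'' x) x
  ode : ∀ x : ℝ, cexp x * f'' x + (b - cexp x) * f' x - a * f x = 0

theorem hasDerivAt_cexp_ofReal (x : ℝ) : HasDerivAt (fun x : ℝ => cexp x) (cexp x) x :=
  (Complex.hasDerivAt_exp (x : ℂ)).comp_ofReal

theorem hasDerivAt_cexp_mul_ofReal (b : ℂ) (x : ℝ) :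
    HasDerivAt (fun x : ℝ => cexp (b * x)) (cexp (b * x) * b) x := by
  have h : HasDerivAt (fun z : ℂ => cexp (b * z)) (cexp (b * x) * (b * 1)) x :=
    ((hasDerivAt_id (x : ℂ)).const_mul b).cexp
  rw [mul_one] at h
  exact h.comp_ofReal

/-- The Wronskian of two solutions of Kummer's equation is a multiple of `z^{-b} e^z`. -/
theorem IsKummerSolution.wronskian_eq {a b : ℂ} {f f' f'' g g' g'' : ℝ → ℂ}
    (hf : IsKummerSolution a b f f' f'') (hg : IsKummerSolution a b g g' g'') {l : ℂ}
    (hl : Tendsto (fun x : ℝ => f x * (cexp (b * x) * g' x) - (cexp (b * x) * f' x) * g x) atBot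
      (𝓝 l)) (x : ℝ) :
    cexp (b * x) * cexp (-cexp x) * (f x * g' x - f' x * g x) = l := by
  set E : ℝ → ℂ := fun x => cexp (b * x) * cexp (-cexp x) * (f x * g' x - f' x * g x) with hE
  have hder : ∀ x, HasDerivAt E 0 x := by
    intro x
    have h1 := ((hasDerivAt_cexp_mul_ofReal b x).mul (hasDerivAt_cexp_ofReal x).neg.cexp).mul
      (((hf.hasDerivAt x).mul (hg.hasDerivAt' x)).sub ((hf.hasDerivAt' x).mul (hg.hasDerivAt x)))
    refine h1.congr_deriv ?_
    simp only [Pi.mul_apply, Pi.sub_apply, Pi.neg_apply]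
    linear_combination cexp (b * x) * cexp (-cexp x) * (f x * hg.ode x - g x * hf.ode x)
  have hconst : ∀ y, E y = E x := fun y =>
    is_const_of_deriv_eq_zero (fun x => (hder x).differentiableAt) (fun x => (hder x).deriv) y x
  have hlim : Tendsto E atBot (𝓝 l) := by
    have h1 : Tendsto (fun x : ℝ => cexp (-cexp x)) atBot (𝓝 1) := by
      have := (Complex.continuous_exp.tendsto _).comp tendsto_cexp_ofReal_atBot.neg
      simpa [Function.comp_def] using this
    have h2 := h1.mul hl
    rw [one_mul] at h2
    refine h2.congr fun x => ?_
    simp only [hE]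
    ring
  refine tendsto_nhds_unique ?_ hlim
  rw [show E = fun _ => E x from funext hconst]
  exact tendsto_const_nhds

theorem isKummerSolution_kummerReg (a b : ℂ) :
    IsKummerSolution a b (fun x => kummerReg a b (cexp x))
      (fun x => a * kummerReg (a + 1) (b + 1) (cexp x))
      (fun x => a * ((a + 1) * kummerReg (a + 2) (b + 2) (cexp x))) where
  hasDerivAt x := by
    have h := ((hasDerivAt_kummerReg a b (cexp x)).comp (x : ℂ)
      (Complex.hasDerivAt_exp (x : ℂ))).comp_ofReal
    exact h.congr_deriv (by ring)
  hasDerivAt' x := by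
    have h := (((hasDerivAt_kummerReg (a + 1) (b + 1) (cexp x)).comp (x : ℂ)
      (Complex.hasDerivAt_exp (x : ℂ))).const_mul a).comp_ofReal
    refine h.congr_deriv ?_
    rw [show a + 1 + 1 = a + 2 by ring, show b + 1 + 1 = b + 2 by ring]
    ring
  ode x := by
    linear_combination a * kummerReg_ode_aux a b (cexp x)

theorem hasDerivAt_cexp_mul_kummerReg (a b : ℂ) (x : ℝ) :
    HasDerivAt (fun x : ℝ => cexp ((b - 1) * x) * kummerReg a b (cexp x))
      (cexp x * (cexp ((b - 2) * x) * kummerReg a (b - 1) (cexp x))) x := by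
  have h := ((hasDerivAt_kummerReg a b (cexp x)).comp (x : ℂ)
    (Complex.hasDerivAt_exp (x : ℂ))).comp_ofReal
  refine ((hasDerivAt_cexp_mul_ofReal (b - 1) x).mul h).congr_deriv ?_
  have e : cexp ((b - 1) * x) = cexp x * cexp ((b - 2) * x) := by
    rw [← Complex.exp_add]
    ring_nf
  simp only [Function.comp_apply]
  rw [e]
  linear_combination cexp x * cexp ((b - 2) * x) * kummerReg_mul_deriv a b (cexp x)

theorem isKummerSolution_cexp_mul_kummerReg (a b : ℂ) :
    IsKummerSolution a b (fun x => cexp ((1 - b) * x) * kummerReg (a - b + 1) (2 - b) (cexp x))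
      (fun x => cexp (-b * x) * kummerReg (a - b + 1) (1 - b) (cexp x))
      (fun x => cexp ((-b - 1) * x) * kummerReg (a - b + 1) (-b) (cexp x)) where
  hasDerivAt x := by
    have h := hasDerivAt_cexp_mul_kummerReg (a - b + 1) (2 - b) x
    rwa [show 2 - b - 1 = 1 - b by ring, show 2 - b - 2 = -b by ring] at h
  hasDerivAt' x := by
    have h := hasDerivAt_cexp_mul_kummerReg (a - b + 1) (1 - b) x
    rwa [show 1 - b - 1 = -b by ring, show 1 - b - 2 = -b - 1 by ring] at h
  ode x := by
    have h := kummerReg_contiguous_right (a - b + 1) (2 - b) (cexp x)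
    rw [show 2 - b - 2 = -b by ring, show 2 - b - 1 = 1 - b by ring] at h
    have e1 : cexp ((1 - b) * x) = cexp x * cexp (-b * x) := by
      rw [← Complex.exp_add]
      ring_nf
    have e2 : cexp (-b * x) = cexp x * cexp ((-b - 1) * x) := by
      rw [← Complex.exp_add]
      ring_nf
    rw [e1, e2]
    linear_combination cexp x * cexp ((-b - 1) * x) * h

theorem isKummerSolution_laplaceInt {a : ℂ} (ha : 0 < a.re) (c : ℂ) :
    IsKummerSolution a (a + c + 1) (fun x => laplaceInt a c (cexp x) 1)
      (fun x => -laplaceInt (a + 1) c (cexp x) 1) (fun x => laplaceInt (a + 2) c (cexp x) 1) where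
  hasDerivAt x := by
    have hp : 0 < (cexp x).re := by rw [← ofReal_exp, ofReal_re]; exact Real.exp_pos x
    have h := ((hasDerivAt_laplaceInt_left (c := c) ha hp (s := 1) (by simp)).comp (x : ℂ)
      (Complex.hasDerivAt_exp (x : ℂ))).comp_ofReal
    exact h.congr_deriv (by ring)
  hasDerivAt' x := by
    have hp : 0 < (cexp x).re := by rw [← ofReal_exp, ofReal_re]; exact Real.exp_pos x
    have h := ((hasDerivAt_laplaceInt_left (a := a + 1) (c := c) (by simp; linarith) hp (s := 1)
      (by simp)).comp (x : ℂ) (Complex.hasDerivAt_exp (x : ℂ))).neg.comp_ofReal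
    refine h.congr_deriv ?_
    rw [show a + 1 + 1 = a + 2 by ring]
    ring
  ode x := by
    have hp : 0 < (cexp x).re := by rw [← ofReal_exp, ofReal_re]; exact Real.exp_pos x
    linear_combination laplaceInt_ode (c := c) ha hp

theorem kummerReg_zero (a b : ℂ) : kummerReg a b 0 = (Gamma b)⁻¹ := by
  rw [kummerReg_eq_tsum, tsum_eq_single 0 (fun n hn => by simp [hn])]
  simp [kummerCoeff]

theorem tendsto_kummerReg_cexp_atBot (a b : ℂ) :
    Tendsto (fun x : ℝ => kummerReg a b (cexp x)) atBot (𝓝 (Gamma b)⁻¹) := by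
  rw [← kummerReg_zero a b]
  exact ((hasDerivAt_kummerReg a b 0).continuousAt.tendsto).comp tendsto_cexp_ofReal_atBot

/-- Three functions I, M₁, M₂ satisfy I·W(M₁,M₂) - M₁·W(I,M₂) + M₂·W(I,M₁) = 0, a determinant with a
repeated row. For 0 < Re b < 1 all limits as z → 0 exist, and the Wronskians, freed of the factor
z^{-b}e^z, are 1/(Γ(b)Γ(1-b)), B(a,1-b)/Γ(1-b) and 1. The reflection formula produces the sine. -/
theorem laplaceInt_connection_of_re {a b : ℂ} (ha : 0 < a.re) (hb0 : 0 < b.re) (hb1 : b.re < 1)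
    (x : ℝ) :
    Complex.sin (Real.pi * b) / Real.pi * laplaceInt a (b - a - 1) (cexp x) 1 =
      Gamma a * ((Gamma (a - b + 1))⁻¹ * kummerReg a b (cexp x)) -
        cexp ((1 - b) * x) * kummerReg (a - b + 1) (2 - b) (cexp x) := by
  have sI := isKummerSolution_laplaceInt ha (b - a - 1)
  rw [show a + (b - a - 1) + 1 = b by ring] at sI
  have s1 := isKummerSolution_kummerReg a b
  have s2 := isKummerSolution_cexp_mul_kummerReg a b
  have hb1' : 0 < (1 - b).re := by simpa using hb1
  have t0 := tendsto_cexp_mul_ofReal_atBot hb0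
  have t1 := tendsto_kummerReg_cexp_atBot a b
  have t1' := t0.mul ((tendsto_kummerReg_cexp_atBot (a + 1) (b + 1)).const_mul a)
  have t2 := (tendsto_cexp_mul_ofReal_atBot hb1').mul
    (tendsto_kummerReg_cexp_atBot (a - b + 1) (2 - b))
  have t2' : Tendsto (fun x : ℝ => cexp (b * x) *
      (cexp (-b * x) * kummerReg (a - b + 1) (1 - b) (cexp x))) atBot (𝓝 (Gamma (1 - b))⁻¹) := by
    refine (tendsto_kummerReg_cexp_atBot (a - b + 1) (1 - b)).congr fun x => ?_
    rw [← mul_assoc, ← Complex.exp_add]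
    simp
  have tI := tendsto_laplaceInt_atBot ha hb1'
  rw [show -(a + (1 - b)) = b - a - 1 by ring] at tI
  have tI' : Tendsto (fun x : ℝ => cexp (b * x) * -laplaceInt (a + 1) (b - a - 1) (cexp x) 1) atBot
      (𝓝 (-Gamma b)) := by
    have h := (tendsto_cexp_mul_laplaceInt_atBot (a := a + 1) (c := b - a - 1)
      (by ring_nf; exact hb0) (by simp; linarith)).neg
    rw [show a + 1 + (b - a - 1) = b by ring] at h
    exact h.congr fun x => by ring
  have w12 := s1.wronskian_eq s2 ((t1.mul t2').sub (t1'.mul t2)) x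
  have wI2 := sI.wronskian_eq s2 ((tI.mul t2').sub (tI'.mul t2)) x
  have wI1 := sI.wronskian_eq s1 ((tI.mul t1').sub (tI'.mul t1)) x
  have hG1 : Gamma (1 - b) ≠ 0 := Gamma_ne_zero_of_re_pos hb1'
  have hG0 : Gamma b ≠ 0 := Gamma_ne_zero_of_re_pos hb0
  have hG2 : Gamma (a - b + 1) ≠ 0 := Gamma_ne_zero_of_re_pos (by simp; linarith)
  have hbeta := Gamma_mul_Gamma_eq_betaIntegral ha hb1'
  rw [show a + (1 - b) = a - b + 1 by ring] at hbeta
  have hrefl := Gamma_mul_Gamma_one_sub b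
  have hpi : (Real.pi : ℂ) ≠ 0 := by exact_mod_cast Real.pi_ne_zero
  have hsin : Complex.sin (Real.pi * b) / Real.pi = (Gamma b)⁻¹ * (Gamma (1 - b))⁻¹ := by
    rw [← mul_inv, hrefl, inv_div]
  have hB : betaIntegral a (1 - b) * (Gamma (1 - b))⁻¹ = Gamma a * (Gamma (a - b + 1))⁻¹ := by
    field_simp
    linear_combination -hbeta
  have hGG : Gamma b * (Gamma b)⁻¹ = 1 := mul_inv_cancel₀ hG0
  set X := cexp (b * x) * cexp (-cexp x)
  rw [hsin]
  linear_combination kummerReg a b (cexp x) * hB -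
      cexp ((1 - b) * x) * kummerReg (a - b + 1) (2 - b) (cexp x) * hGG -
      laplaceInt a (b - a - 1) (cexp x) 1 * w12 + kummerReg a b (cexp x) * wI2 -
      cexp ((1 - b) * x) * kummerReg (a - b + 1) (2 - b) (cexp x) * wI1

theorem Differentiable.eq_of_eventuallyEq {f g : ℂ → ℂ} (hf : Differentiable ℂ f)
    (hg : Differentiable ℂ g) {z₀ : ℂ} (h : f =ᶠ[𝓝 z₀] g) : f = g :=
  AnalyticOnNhd.eq_of_eventuallyEq (fun z _ => hf.analyticAt z) (fun z _ => hg.analyticAt z) h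

/-- The regularised normalisation makes both sides entire in b, and they agree near b = 1/2. -/
theorem laplaceInt_connection {a : ℂ} (ha : 0 < a.re) (b : ℂ) (x : ℝ) :
    Complex.sin (Real.pi * b) / Real.pi * laplaceInt a (b - a - 1) (cexp x) 1 =
      Gamma a * ((Gamma (a - b + 1))⁻¹ * kummerReg a b (cexp x)) -
        cexp ((1 - b) * x) * kummerReg (a - b + 1) (2 - b) (cexp x) := by
  have hp : 0 < (cexp x).re := by rw [← ofReal_exp, ofReal_re]; exact Real.exp_pos x
  have h1 : Differentiable ℂ fun b => laplaceInt a (b - a - 1) (cexp x) 1 := fun b =>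
    (hasDerivAt_laplaceInt ha (c := fun b => b - a - 1) (p := fun _ => cexp x) (s := fun _ => 1)
      (by fun_prop) (by fun_prop) (by fun_prop) hp (by simp)).differentiableAt
  have h2 : Differentiable ℂ fun b => kummerReg a b (cexp x) :=
    differentiable_kummerReg (by fun_prop) (by fun_prop) (by fun_prop)
  have h3 : Differentiable ℂ fun b => kummerReg (a - b + 1) (2 - b) (cexp x) :=
    differentiable_kummerReg (by fun_prop) (by fun_prop) (by fun_prop)
  have h4 : Differentiable ℂ fun b => (Gamma (a - b + 1))⁻¹ :=
    differentiable_one_div_Gamma.comp (by fun_prop)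
  refine congrFun (Differentiable.eq_of_eventuallyEq (z₀ := 1 / 2)
    (f := fun b => Complex.sin (Real.pi * b) / Real.pi * laplaceInt a (b - a - 1) (cexp x) 1)
    (g := fun b => Gamma a * ((Gamma (a - b + 1))⁻¹ * kummerReg a b (cexp x)) -
        cexp ((1 - b) * x) * kummerReg (a - b + 1) (2 - b) (cexp x))
    ?_ ?_ ?_) b
  · exact ((by fun_prop : Differentiable ℂ fun b => Complex.sin (Real.pi * b)).div_const _).mul h1
  · exact ((h4.mul h2).const_mul _).sub
      ((by fun_prop : Differentiable ℂ fun b : ℂ => cexp ((1 - b) * x)).mul h3)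
  · have e1 : ∀ᶠ b : ℂ in 𝓝 (1 / 2), 0 < b.re :=
      (continuous_re.tendsto _).eventually_const_lt (by norm_num)
    have e2 : ∀ᶠ b : ℂ in 𝓝 (1 / 2), b.re < 1 :=
      (continuous_re.tendsto _).eventually_lt_const (by norm_num)
    filter_upwards [e1, e2] with b hb0 hb1 using laplaceInt_connection_of_re ha hb0 hb1 x

/-! ### Integral representation of the Whittaker function -/

theorem whittakerMReg_eq (κ μ w : ℂ) :
    whittakerMReg κ μ w = cexp (-cexp w / 2) * cexp ((1 / 2 + μ) * w) *
      kummerReg (1 / 2 + μ - κ) (1 + 2 * μ) (cexp w) := rfl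

theorem differentiable_whittakerMReg {κ μ w : ℂ → ℂ} (hκ : Differentiable ℂ κ)
    (hμ : Differentiable ℂ μ) (hw : Differentiable ℂ w) :
    Differentiable ℂ fun ζ => whittakerMReg (κ ζ) (μ ζ) (w ζ) := by
  simp only [whittakerMReg_eq]
  refine Differentiable.mul (by fun_prop) ?_
  exact differentiable_kummerReg (by fun_prop) (by fun_prop) (by fun_prop)

theorem differentiable_whittakerWGeneric (κ μ : ℂ) :
    Differentiable ℂ fun w => whittakerWGeneric κ μ w := by
  have h1 := differentiable_whittakerMReg (κ := fun _ => κ) (μ := fun _ => μ) (w := fun w => w)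
    (by fun_prop) (by fun_prop) (by fun_prop)
  have h2 := differentiable_whittakerMReg (κ := fun _ => κ) (μ := fun _ => -μ) (w := fun w => w)
    (by fun_prop) (by fun_prop) (by fun_prop)
  unfold whittakerWGeneric
  exact ((h2.div_const _).sub (h1.div_const _)).const_mul _

/-- The connection formula at b = 1+2μ, where the Frobenius solutions correspond to the indices μ
and -μ and the sine becomes -sin(2πμ). -/
theorem whittakerWGeneric_ofReal {κ μ : ℂ} (ha : 0 < (1 / 2 + μ - κ).re)
    (hμ : Complex.sin (2 * Real.pi * μ) ≠ 0) (x : ℝ) :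
    whittakerWGeneric κ μ x = cexp (-cexp x / 2) * cexp ((1 / 2 + μ) * x) *
      ((Gamma (1 / 2 + μ - κ))⁻¹ * laplaceInt (1 / 2 + μ - κ) (μ + κ - 1 / 2) (cexp x) 1) := by
  have h := laplaceInt_connection ha (1 + 2 * μ) x
  have hG := Gamma_ne_zero_of_re_pos ha
  have hpi : (Real.pi : ℂ) ≠ 0 := by exact_mod_cast Real.pi_ne_zero
  rw [show 1 + 2 * μ - (1 / 2 + μ - κ) - 1 = μ + κ - 1 / 2 by ring,
    show 1 / 2 + μ - κ - (1 + 2 * μ) + 1 = 1 / 2 - μ - κ by ring,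
    show (1 : ℂ) - (1 + 2 * μ) = -2 * μ by ring,
    show (2 : ℂ) - (1 + 2 * μ) = 1 + 2 * -μ by ring,
    show (Real.pi : ℂ) * (1 + 2 * μ) = 2 * Real.pi * μ + Real.pi by ring, Complex.sin_add_pi] at h
  have e : cexp ((1 / 2 + -μ) * x) = cexp ((1 / 2 + μ) * x) * cexp (-2 * μ * x) := by
    rw [← Complex.exp_add]
    ring_nf
  rw [whittakerWGeneric, whittakerMReg_eq, whittakerMReg_eq, e,
    show 1 / 2 + -μ - κ = 1 / 2 - μ - κ by ring]
  set S := Complex.sin (2 * Real.pi * μ)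
  set L := laplaceInt (1 / 2 + μ - κ) (μ + κ - 1 / 2) (cexp x) 1
  set G := Gamma (1 / 2 + μ - κ)
  have h' : L = Real.pi / S * (cexp (-2 * μ * x) * kummerReg (1 / 2 - μ - κ) (1 + 2 * -μ) (cexp x) -
      G * ((Gamma (1 / 2 - μ - κ))⁻¹ * kummerReg (1 / 2 + μ - κ) (1 + 2 * μ) (cexp x))) := by
    field_simp at h ⊢
    linear_combination -h
  rw [h']
  field_simp

theorem abs_im_div_three_lt {w : ℂ} (hw : |w.im| < 3 * Real.pi / 2) :
    |(w / 3).im| < Real.pi / 2 := by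
  have : (w / 3).im = w.im / 3 := by simp
  rw [this, abs_div, abs_of_pos (by norm_num : (0 : ℝ) < 3)]
  linarith

theorem re_cexp_pos {u : ℂ} (hu : |u.im| < Real.pi / 2) : 0 < (cexp u).re := by
  rw [exp_re]
  have := abs_lt.1 hu
  exact mul_pos (Real.exp_pos _) (Real.cos_pos_of_mem_Ioo ⟨by linarith [this.1], this.2⟩)

/-- Two holomorphic functions on a strip around the real axis agree if they agree on the real
axis. -/
theorem eq_of_eq_ofReal_of_strip {R : ℝ} {f g : ℂ → ℂ}
    (hf : DifferentiableOn ℂ f {w | |w.im| < R}) (hg : DifferentiableOn ℂ g {w | |w.im| < R})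
    (h : ∀ x : ℝ, f x = g x) {w : ℂ} (hw : |w.im| < R) : f w = g w := by
  have hUo : IsOpen {w : ℂ | |w.im| < R} :=
    isOpen_lt (continuous_abs.comp continuous_im) continuous_const
  have hUc : Convex ℝ {w : ℂ | |w.im| < R} := by
    have : {w : ℂ | |w.im| < R} = Complex.imLm ⁻¹' Metric.ball 0 R := by
      ext w
      simp
    rw [this]
    exact (convex_ball _ _).linear_preimage _
  refine (hf.analyticOnNhd hUo).eqOn_of_preconnected_of_frequently_eq (hg.analyticOnNhd hUo)
    hUc.isPreconnected (z₀ := 0) ?_ ?_ hw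
  · simpa using (abs_nonneg _).trans_lt hw
  have ht : Tendsto (fun x : ℝ => (x : ℂ)) (𝓝[≠] 0) (𝓝[≠] 0) := by
    refine tendsto_nhdsWithin_iff.2 ⟨?_, ?_⟩
    · exact (continuous_ofReal.tendsto' 0 0 (by simp)).mono_left nhdsWithin_le_nhds
    · filter_upwards [self_mem_nhdsWithin] with x hx
      simpa using hx
  exact ht.frequently (Eventually.frequently (.of_forall h))

/-- The representation of `W_{κ,μ}` by an absolutely convergent integral that is holomorphic in the
whole sector `|arg z| < 3π/2`. -/
theorem whittakerWGeneric_eq_laplaceInt {κ μ : ℂ} (ha : 0 < (1 / 2 + μ - κ).re)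
    (hμ : Complex.sin (2 * Real.pi * μ) ≠ 0) {w : ℂ} (hw : |w.im| < 3 * Real.pi / 2) :
    whittakerWGeneric κ μ w = cexp (-cexp w / 2) * cexp (κ * w) *
      (cexp ((1 / 2 + μ - κ) * (w / 3)) * ((Gamma (1 / 2 + μ - κ))⁻¹ *
        laplaceInt (1 / 2 + μ - κ) (μ + κ - 1 / 2) (cexp (w / 3)) (cexp (-(w / 3))))) := by
  set U : Set ℂ := {w | |w.im| < 3 * Real.pi / 2}
  have hJ : DifferentiableOn ℂ (fun w => laplaceInt (1 / 2 + μ - κ) (μ + κ - 1 / 2) (cexp (w / 3))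
      (cexp (-(w / 3)))) U := by
    intro w hw
    refine (hasDerivAt_laplaceInt ha (c := fun _ => μ + κ - 1 / 2) (p := fun w => cexp (w / 3))
      (s := fun w => cexp (-(w / 3))) (by fun_prop) (by fun_prop) (by fun_prop)
      ?_ ?_).differentiableAt.differentiableWithinAt
    · exact re_cexp_pos (abs_im_div_three_lt hw)
    · refine re_cexp_pos ?_
      rw [neg_im, abs_neg]
      exact abs_im_div_three_lt hw
  have hR : DifferentiableOn ℂ (fun w => cexp (-cexp w / 2) * cexp (κ * w) *
      (cexp ((1 / 2 + μ - κ) * (w / 3)) * ((Gamma (1 / 2 + μ - κ))⁻¹ *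
        laplaceInt (1 / 2 + μ - κ) (μ + κ - 1 / 2) (cexp (w / 3)) (cexp (-(w / 3)))))) U := by
    refine DifferentiableOn.mul (by fun_prop) (DifferentiableOn.mul (by fun_prop) ?_)
    exact hJ.const_mul _
  refine eq_of_eq_ofReal_of_strip (differentiable_whittakerWGeneric κ μ).differentiableOn hR
    (fun x => ?_) hw
  -- Rescaling by z^{-2/3} replaces p = z, s = 1 by p = z^{1/3}, s = z^{-1/3}.
  rw [whittakerWGeneric_ofReal ha hμ, laplaceInt_scale _ _ _ _ (-(x / 3))]
  have e1 : cexp x * cexp (2 * ((-(x / 3) : ℝ) : ℂ)) = cexp (x / 3) := by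
    rw [← Complex.exp_add]
    push_cast
    ring_nf
  have e2 : cexp ((1 / 2 + μ) * x) * cexp (2 * ((-(x / 3) : ℝ) : ℂ) * (1 / 2 + μ - κ)) =
      cexp (κ * x) * cexp ((1 / 2 + μ - κ) * (x / 3)) := by
    rw [← Complex.exp_add, ← Complex.exp_add]
    push_cast
    ring_nf
  have e3 : ((-(x / 3) : ℝ) : ℂ) = -(x / 3) := by push_cast; rfl
  rw [e3] at e2
  rw [e1, one_mul, e3]
  linear_combination cexp (-cexp x / 2) * ((Gamma (1 / 2 + μ - κ))⁻¹ *
    laplaceInt (1 / 2 + μ - κ) (μ + κ - 1 / 2) (cexp (x / 3)) (cexp (-(x / 3)))) * e2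

/-! ### Watson's lemma -/

/-- The Laplace transform of a power. -/
theorem laplaceInt_zero_mid {a : ℂ} (ha : 0 < a.re) {u : ℂ} (hu : |u.im| < Real.pi / 2) (s : ℂ) :
    laplaceInt a 0 (cexp u) s = cexp (-(a * u)) * Gamma a := by
  have hs : laplaceInt a 0 (cexp u) s = laplaceInt a 0 (cexp u) 1 := by
    simp [laplaceInt, laplaceIntegrand]
  rw [hs]
  refine eq_of_eq_ofReal_of_strip (f := fun u => laplaceInt a 0 (cexp u) 1)
    (g := fun u => cexp (-(a * u)) * Gamma a) (fun u hu => ?_) (by fun_prop) (fun x => ?_) hu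
  · exact (hasDerivAt_laplaceInt ha (c := fun _ => 0) (p := fun u => cexp u) (s := fun _ => 1)
      (by fun_prop) (by fun_prop) (by fun_prop) (re_cexp_pos hu) (by simp)
      ).differentiableAt.differentiableWithinAt
  · rw [laplaceInt_scale _ _ _ _ (-x / 2), Gamma_eq_integral ha, GammaIntegral]
    have e : cexp x * cexp (2 * ((-x / 2 : ℝ) : ℂ)) = 1 := by
      rw [← Complex.exp_add]
      push_cast
      ring_nf
      simp
    rw [e]
    simp only [laplaceInt, laplaceIntegrand, cpow_zero, mul_one, one_mul]
    push_cast
    ring_nf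

theorem laplaceIntegrand_add_natCast (a c p s : ℂ) {r : ℝ} (hr : 0 < r) (n : ℕ) :
    laplaceIntegrand (a + n) c p s r = r ^ n * laplaceIntegrand a c p s r := by
  induction n with
  | zero => simp
  | succ n ih =>
    rw [Nat.cast_succ, ← add_assoc, laplaceIntegrand_add_one_left _ _ _ _ hr, ih]
    ring

/-- The asymptotic expansion of the Laplace integral (Watson's lemma with explicit remainder). -/
theorem exists_norm_laplaceInt_sub_le {σ : ℝ} (hσ : 0 < σ) (hσ1 : σ ≤ 1) (N K : ℕ) :
    ∃ C : ℝ, 0 ≤ C ∧ ∀ a c u : ℂ, 0 < a.re → ‖c‖ ≤ K → |u.im| < Real.pi / 2 →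
      σ ≤ Real.cos u.im → 0 ≤ u.re →
      ‖laplaceInt a c (cexp u) (cexp (-u)) - ∑ n ∈ Finset.range N, binomCoeff c n *
          cexp (-(2 * n * u)) * (cexp (-((a + n) * u)) * Gamma (a + n))‖ ≤
        C * ((2 / σ) ^ (a.re + N) * Real.Gamma (a.re + N)) *
          Real.exp (-((a.re + 3 * N) * u.re)) := by
  obtain ⟨C, hC, hrem⟩ := exists_norm_binomRem_le hσ hσ1 N K
  -- The constant of `one_add_mul_pow_le_exp` for B = P = e^{Re u} and τ = σP/2. The powers of P
  -- cancel, so D does not depend on u.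
  set D : ℝ := (2 / σ) ^ (K + N) * (K + N).factorial * Real.exp (σ / 2) with hD
  have hD0 : 0 ≤ D := by positivity
  refine ⟨C * D, by positivity, fun a c u ha hc hu hcos hu0 => ?_⟩
  set p := cexp u with hp
  set s := cexp (-u) with hs
  set P : ℝ := Real.exp u.re with hP
  have hP0 : 0 < P := Real.exp_pos _
  have hP1 : 1 ≤ P := Real.one_le_exp hu0
  have hpre : p.re = P * Real.cos u.im := exp_re u
  have hp0 : 0 < p.re := re_cexp_pos hu
  have hs0 : 0 < s.re := re_cexp_pos (by rwa [neg_im, abs_neg])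
  have hsn : ‖s‖ = P⁻¹ := by rw [hs, norm_exp, neg_re, Real.exp_neg]
  have hsσ : σ * ‖s‖ ≤ s.re := by
    rw [hsn, hs, exp_re, neg_re, neg_im, Real.cos_neg, Real.exp_neg, mul_comm]
    gcongr
  have han : ∀ n : ℕ, 0 < (a + n).re := fun n => by
    simp only [add_re, natCast_re]
    positivity
  have hsum : ∀ n : ℕ, binomCoeff c n * cexp (-(2 * n * u)) *
      (cexp (-((a + n) * u)) * Gamma (a + n)) =
      ∫ r in Ioi (0 : ℝ), binomCoeff c n * (s ^ 2) ^ n * laplaceIntegrand (a + n) 0 p s r := by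
    intro n
    rw [integral_const_mul, ← laplaceInt, hp, laplaceInt_zero_mid (han n) hu, hs,
      ← Complex.exp_nat_mul, ← Complex.exp_nat_mul]
    push_cast
    ring_nf
  have hi : ∀ n : ℕ, IntegrableOn (fun r =>
      binomCoeff c n * (s ^ 2) ^ n * laplaceIntegrand (a + n) 0 p s r) (Ioi 0) := fun n =>
    (integrableOn_laplaceIntegrand (han n) hp0 hs0).const_mul _
  rw [Finset.sum_congr rfl fun n _ => hsum n, ← integral_finsetSum _ fun n _ => hi n, laplaceInt,
    ← integral_sub (integrableOn_laplaceIntegrand ha hp0 hs0)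
      (integrable_finsetSum _ fun n _ => hi n)]
  have hη : 0 < σ / 2 * P := by positivity
  have hx : 0 < a.re + N := by positivity
  have hbound : ∀ r ∈ Ioi (0 : ℝ), ‖laplaceIntegrand a c p s r - ∑ n ∈ Finset.range N,
      binomCoeff c n * (s ^ 2) ^ n * laplaceIntegrand (a + n) 0 p s r‖ ≤
      C * D * (P⁻¹ ^ 2) ^ N * (r ^ (a.re + N - 1) * Real.exp (-(σ / 2 * P * r))) := by
    intro r hr
    have hr : 0 < r := hr
    have e1 : laplaceIntegrand a c p s r - ∑ n ∈ Finset.range N,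
        binomCoeff c n * (s ^ 2) ^ n * laplaceIntegrand (a + n) 0 p s r =
        cexp (-(p * r)) * (r : ℂ) ^ (a - 1) * binomRem N c (s ^ 2 * r) := by
      rw [binomRem, mul_sub, Finset.mul_sum]
      refine congrArg₂ _ rfl (Finset.sum_congr rfl fun n _ => ?_)
      rw [laplaceIntegrand_add_natCast _ _ _ _ hr, laplaceIntegrand, cpow_zero, mul_pow]
      ring
    have h1 := hrem c hc s hs0 hsσ r hr.le
    rw [hsn] at h1
    have h2 : (1 + P⁻¹ ^ 2 * r) ^ (K + N) ≤ D * Real.exp (σ / 2 * P * r) := by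
      have h3 := one_add_mul_pow_le_exp (B := P) (τ := σ / 2 * P) hP0 hη hr.le (K + N)
      rw [show P / (σ / 2 * P) = 2 / σ by field_simp, show σ / 2 * P / P = σ / 2 by field_simp]
        at h3
      refine le_trans ?_ h3
      have h4 : P⁻¹ ^ 2 ≤ 1 := pow_le_one₀ (by positivity) (inv_le_one_of_one_le₀ hP1)
      gcongr
      linarith
    have h5 : Real.exp (-(p.re * r)) ≤
        Real.exp (-(σ / 2 * P * r)) * Real.exp (-(σ / 2 * P * r)) := by
      rw [← Real.exp_add, Real.exp_le_exp, hpre]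
      have : P * σ * r ≤ P * Real.cos u.im * r := by gcongr
      linarith
    have h6 : Real.exp (-(σ / 2 * P * r)) * Real.exp (σ / 2 * P * r) = 1 := by
      rw [← Real.exp_add]; simp
    have h7 : r ^ (a.re + N - 1) = r ^ (a.re - 1) * r ^ N := by
      rw [← Real.rpow_natCast, ← Real.rpow_add hr]
      ring_nf
    rw [e1, norm_mul, norm_mul, norm_exp, norm_cpow_eq_rpow_re_of_pos hr, h7]
    simp only [neg_re, re_mul_ofReal, sub_re, one_re]
    calc Real.exp (-(p.re * r)) * r ^ (a.re - 1) * ‖binomRem N c (s ^ 2 * r)‖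
        ≤ (Real.exp (-(σ / 2 * P * r)) * Real.exp (-(σ / 2 * P * r))) * r ^ (a.re - 1) *
          (C * (P⁻¹ ^ 2 * r) ^ N * (D * Real.exp (σ / 2 * P * r))) := by
          gcongr
          exact h1.trans (by gcongr)
      _ = (Real.exp (-(σ / 2 * P * r)) * Real.exp (σ / 2 * P * r)) * (C * D * (P⁻¹ ^ 2) ^ N *
          (r ^ (a.re - 1) * r ^ N * Real.exp (-(σ / 2 * P * r)))) := by ring
      _ = _ := by rw [h6, one_mul]
  refine (norm_integral_le_of_norm_le ((integrableOn_rpow_mul_exp_neg_mul hx hη).const_mul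
    (C * D * (P⁻¹ ^ 2) ^ N)) ?_).trans (le_of_eq ?_)
  · filter_upwards [ae_restrict_mem measurableSet_Ioi] with r hr using hbound r hr
  -- The factor ‖s‖^{2N} gives P^{-2N} and the Gamma integral gives P^{-(Re a+N)}. With u = w/3 the
  -- total is |z|^{-Re a/3-N}, and the prefactor z^{a/3} will cancel the first part.
  · rw [integral_const_mul, Real.integral_rpow_mul_exp_neg_mul_Ioi hx hη]
    have e1 : (1 / (σ / 2 * P)) ^ (a.re + N) = (2 / σ) ^ (a.re + N) *
        Real.exp (-((a.re + N) * u.re)) := by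
      rw [show 1 / (σ / 2 * P) = (2 / σ) * P⁻¹ by field_simp,
        Real.mul_rpow (by positivity) (by positivity), hP, ← Real.exp_neg, ← Real.exp_mul]
      ring_nf
    have e2 : (P⁻¹ ^ 2) ^ N = Real.exp (-(2 * N * u.re)) := by
      rw [hP, ← Real.exp_neg, ← Real.exp_nat_mul, ← Real.exp_nat_mul]
      push_cast
      ring_nf
    have e3 : Real.exp (-((a.re + 3 * N) * u.re)) =
        Real.exp (-(2 * N * u.re)) * Real.exp (-((a.re + N) * u.re)) := by
      rw [← Real.exp_add]
      ring_nf
    rw [e1, e2, e3]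
    ring

/-! ### The remainder bound when Re(1/2+μ-κ) > 0 -/

/-- The remainder of the asymptotic expansion of `e^{z/2} z^{-κ} W_{κ,μ}(z)`, `z = e^w`. -/
noncomputable def whittakerRem (κ : ℂ) (N : ℕ) (μ w : ℂ) : ℂ :=
  cexp (cexp w / 2) * cexp (-(κ * w)) * whittakerWGeneric κ μ w -
    ∑ n ∈ Finset.range N, whittakerCoeff κ n μ * ((-cexp w) ^ n)⁻¹

/-- The remainder is bounded by a multiple of `|z|^{-N}`, uniformly on bounded sets of indices. -/
def WhittakerRemBound (κ : ℂ) (δ : ℝ) (K N : ℕ) : Prop :=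
  ∃ C : ℝ, 0 ≤ C ∧ ∀ μ : ℂ, ‖μ‖ ≤ K → Complex.sin (2 * Real.pi * μ) ≠ 0 → ∀ w : ℂ,
    |w.im| ≤ 3 * Real.pi / 2 - δ → 0 ≤ w.re → ‖whittakerRem κ N μ w‖ ≤ C * Real.exp (-(N * w.re))

theorem Gamma_inv_mul_Gamma_add_natCast {a : ℂ} (ha : 0 < a.re) (n : ℕ) :
    (Gamma a)⁻¹ * Gamma (a + n) = (ascPochhammer ℂ n).eval a := by
  rw [← Gamma_add_nat_div_Gamma_eq a (fun k hk => ?_), div_eq_inv_mul]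
  rw [hk] at ha
  simp only [neg_re, natCast_re] at ha
  linarith [(Nat.cast_nonneg k : (0 : ℝ) ≤ k)]

theorem whittakerRem_eq {κ μ : ℂ} (ha : 0 < (1 / 2 + μ - κ).re)
    (hμ : Complex.sin (2 * Real.pi * μ) ≠ 0) (N : ℕ) {w : ℂ} (hw : |w.im| < 3 * Real.pi / 2) :
    whittakerRem κ N μ w = (Gamma (1 / 2 + μ - κ))⁻¹ * cexp ((1 / 2 + μ - κ) * (w / 3)) *
      (laplaceInt (1 / 2 + μ - κ) (μ + κ - 1 / 2) (cexp (w / 3)) (cexp (-(w / 3))) -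
        ∑ n ∈ Finset.range N, binomCoeff (μ + κ - 1 / 2) n * cexp (-(2 * n * (w / 3))) *
          (cexp (-((1 / 2 + μ - κ + n) * (w / 3))) * Gamma (1 / 2 + μ - κ + n))) := by
  have e1 : cexp (cexp w / 2) * cexp (-cexp w / 2) = 1 := by
    rw [← Complex.exp_add]
    ring_nf
    simp
  have e2 : cexp (-(κ * w)) * cexp (κ * w) = 1 := by
    rw [← Complex.exp_add]
    simp
  rw [whittakerRem, whittakerWGeneric_eq_laplaceInt ha hμ hw, mul_sub, Finset.mul_sum]
  congr 1
  · linear_combination (cexp (-(κ * w)) * cexp (κ * w) *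
      (cexp ((1 / 2 + μ - κ) * (w / 3)) * ((Gamma (1 / 2 + μ - κ))⁻¹ *
        laplaceInt (1 / 2 + μ - κ) (μ + κ - 1 / 2) (cexp (w / 3)) (cexp (-(w / 3)))))) * e1 +
      (cexp ((1 / 2 + μ - κ) * (w / 3)) * ((Gamma (1 / 2 + μ - κ))⁻¹ *
        laplaceInt (1 / 2 + μ - κ) (μ + κ - 1 / 2) (cexp (w / 3)) (cexp (-(w / 3))))) * e2
  · refine Finset.sum_congr rfl fun n _ => ?_
    have e3 : cexp ((1 / 2 + μ - κ) * (w / 3)) * cexp (-(2 * n * (w / 3))) *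
        cexp (-((1 / 2 + μ - κ + n) * (w / 3))) = (cexp w ^ n)⁻¹ := by
      rw [← Complex.exp_add, ← Complex.exp_add, ← Complex.exp_nat_mul, ← Complex.exp_neg]
      ring_nf
    have e4 : ((-1 : ℂ) ^ n)⁻¹ = (-1) ^ n := by rw [← inv_pow]; norm_num
    rw [whittakerCoeff, binomCoeff, ← Gamma_inv_mul_Gamma_add_natCast ha, neg_pow, mul_inv, e4,
      ← e3, show -(μ + κ - 1 / 2) = 1 / 2 - μ - κ by ring]
    ring

/-- The hypothesis makes Re(1/2+μ-κ) positive on the whole closed disc ‖μ‖ ≤ K. The constants from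
Watson's lemma are continuous in μ there, hence bounded by compactness. -/
theorem whittakerRemBound_of_lt {κ : ℂ} {K : ℕ} (hκ : K < 1 / 2 - κ.re) {δ : ℝ} (hδ : 0 < δ)
    (N : ℕ) : WhittakerRemBound κ δ K N := by
  by_cases hδ' : δ ≤ 3 * Real.pi / 2
  swap
  -- For δ > 3π/2 the sector is empty.
  · exact ⟨0, le_rfl, fun μ _ _ w hw => absurd ((abs_nonneg _).trans hw) (by linarith)⟩
  have hre : ∀ μ : ℂ, ‖μ‖ ≤ K → 0 < (1 / 2 + μ - κ).re := by
    intro μ hμ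
    have h1 := (neg_le_abs μ.re).trans (abs_re_le_norm μ)
    simp
    linarith
  have hpi := Real.pi_pos
  -- On the sector |arg z^{1/3}| ≤ π/2 - δ/3.
  set σ := Real.cos (Real.pi / 2 - δ / 3) with hσ
  have hσ0 : 0 < σ := Real.cos_pos_of_mem_Ioo ⟨by linarith, by linarith⟩
  obtain ⟨M, hM⟩ := exists_nat_ge (K + ‖κ - 1 / 2‖)
  obtain ⟨C, hC, h⟩ := exists_norm_laplaceInt_sub_le hσ0 (Real.cos_le_one _) N M
  have hcont : ContinuousOn (fun μ : ℂ => ‖(Gamma (1 / 2 + μ - κ))⁻¹‖ *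
      Real.exp (|(1 / 2 + μ - κ).im| * (Real.pi / 2)) *
      (C * ((2 / σ) ^ ((1 / 2 + μ - κ).re + N) * Real.Gamma ((1 / 2 + μ - κ).re + N))))
      (Metric.closedBall 0 K) := by
    intro μ hμ
    have hμ' := hre μ (by simpa using hμ)
    refine ContinuousAt.continuousWithinAt ?_
    have c1 : Continuous fun μ : ℂ => ((1 / 2 + μ - κ).re + N : ℝ) := by fun_prop
    have c2 : Continuous fun μ : ℂ => (Gamma (1 / 2 + μ - κ))⁻¹ :=
      differentiable_one_div_Gamma.continuous.comp (by fun_prop)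
    have c3 : Continuous fun μ : ℂ => (2 / σ) ^ ((1 / 2 + μ - κ).re + N) :=
      (Real.continuous_const_rpow (by positivity)).comp c1
    have c4 : ContinuousAt (fun μ : ℂ => Real.Gamma ((1 / 2 + μ - κ).re + N)) μ := by
      refine ContinuousAt.comp (g := Real.Gamma) ?_ c1.continuousAt
      refine (Real.differentiableAt_Gamma fun m => ?_).continuousAt
      have : (0 : ℝ) ≤ m := by positivity
      have : (0 : ℝ) ≤ N := by positivity
      linarith
    exact (c2.norm.mul (by fun_prop)).continuousAt.mul
      ((c3.continuousAt.mul c4).const_mul C)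
  obtain ⟨A, hA⟩ := (isCompact_closedBall (0 : ℂ) (K : ℝ)).exists_bound_of_continuousOn hcont
  refine ⟨|A|, abs_nonneg _, fun μ hμ hsin w hw hw0 => ?_⟩
  have hw' : |w.im| < 3 * Real.pi / 2 := by linarith
  have ha := hre μ hμ
  have hA' := (le_abs_self _).trans ((hA μ (by simpa using hμ)).trans (le_abs_self A))
  rw [whittakerRem_eq ha hsin N hw']
  have him : (w / 3).im = w.im / 3 := by simp
  have hre3 : (w / 3).re = w.re / 3 := by simp
  have hc : ‖μ + κ - 1 / 2‖ ≤ M := by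
    rw [add_sub_assoc]
    exact (norm_add_le _ _).trans (le_trans (by gcongr) hM)
  have hcos : σ ≤ Real.cos (w / 3).im := by
    rw [him, ← Real.cos_abs (w.im / 3), hσ, abs_div, abs_of_pos (by norm_num : (0 : ℝ) < 3)]
    exact Real.cos_le_cos_of_nonneg_of_le_pi (by positivity) (by linarith) (by linarith)
  have hb := h (1 / 2 + μ - κ) (μ + κ - 1 / 2) (w / 3) ha hc (abs_im_div_three_lt hw') hcos
    (by rw [hre3]; positivity)
  set a := 1 / 2 + μ - κ
  have hexp : ‖cexp (a * (w / 3))‖ ≤ Real.exp (a.re * (w.re / 3)) *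
      Real.exp (|a.im| * (Real.pi / 2)) := by
    rw [norm_exp, ← Real.exp_add, Real.exp_le_exp, mul_re, hre3, him]
    have h1 : -(a.im * (w.im / 3)) ≤ |a.im| * (Real.pi / 2) := by
      refine (neg_le_abs _).trans ?_
      rw [abs_mul]
      have := (abs_im_div_three_lt hw').le
      rw [him] at this
      gcongr
    linarith
  have hE : Real.exp (-(N * w.re)) =
      Real.exp (a.re * (w.re / 3)) * Real.exp (-((a.re + 3 * N) * (w / 3).re)) := by
    rw [← Real.exp_add, hre3]
    ring_nf
  rw [norm_mul, norm_mul, hE]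
  calc _ ≤ ‖(Gamma a)⁻¹‖ * (Real.exp (a.re * (w.re / 3)) * Real.exp (|a.im| * (Real.pi / 2))) *
        (C * ((2 / σ) ^ (a.re + N) * Real.Gamma (a.re + N)) *
          Real.exp (-((a.re + 3 * N) * (w / 3).re))) := by gcongr
    _ = (‖(Gamma a)⁻¹‖ * Real.exp (|a.im| * (Real.pi / 2)) *
        (C * ((2 / σ) ^ (a.re + N) * Real.Gamma (a.re + N)))) *
        (Real.exp (a.re * (w.re / 3)) * Real.exp (-((a.re + 3 * N) * (w / 3).re))) := by ring
    _ ≤ _ := by gcongr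

/-! ### Recurrence in κ and removal of the restriction on κ -/

theorem whittakerMReg_div_Gamma_recurrence (κ μ w : ℂ) :
    whittakerMReg (κ + 1) μ w / Gamma (1 / 2 - μ - (κ + 1)) =
      (cexp w - 2 * κ) * (whittakerMReg κ μ w / Gamma (1 / 2 - μ - κ)) -
        (1 / 2 + μ - κ) * (1 / 2 - μ - κ) *
          (whittakerMReg (κ - 1) μ w / Gamma (1 / 2 - μ - (κ - 1))) := by
  have h := kummerReg_contiguous_left (1 / 2 + μ - κ) (1 + 2 * μ) (cexp w)
  have g1 := one_div_Gamma_eq_self_mul_one_div_Gamma_add_one (1 / 2 - μ - (κ + 1))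
  have g2 := one_div_Gamma_eq_self_mul_one_div_Gamma_add_one (1 / 2 - μ - κ)
  rw [show 1 / 2 - μ - (κ + 1) + 1 = 1 / 2 - μ - κ by ring] at g1
  rw [show 1 / 2 - μ - κ + 1 = 1 / 2 - μ - (κ - 1) by ring] at g2
  rw [div_eq_mul_inv (whittakerMReg (κ + 1) μ w), div_eq_mul_inv (whittakerMReg κ μ w),
    div_eq_mul_inv (whittakerMReg (κ - 1) μ w), g1, g2, whittakerMReg_eq, whittakerMReg_eq,
    whittakerMReg_eq, show 1 / 2 + μ - (κ + 1) = 1 / 2 + μ - κ - 1 by ring,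
    show 1 / 2 + μ - (κ - 1) = 1 / 2 + μ - κ + 1 by ring]
  linear_combination -(cexp (-cexp w / 2) * cexp ((1 / 2 + μ) * w) * (1 / 2 - μ - κ) *
    (Gamma (1 / 2 - μ - (κ - 1)))⁻¹) * h

/-- The coefficients of the recurrence are even in μ, so both terms of the connection formula
satisfy the same one. -/
theorem whittakerWGeneric_recurrence (κ μ w : ℂ) :
    whittakerWGeneric (κ + 1) μ w = (cexp w - 2 * κ) * whittakerWGeneric κ μ w -
      (1 / 2 + μ - κ) * (1 / 2 - μ - κ) * whittakerWGeneric (κ - 1) μ w := by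
  have h1 := whittakerMReg_div_Gamma_recurrence κ μ w
  have h2 := whittakerMReg_div_Gamma_recurrence κ (-μ) w
  simp only [sub_neg_eq_add, ← sub_eq_add_neg] at h2
  simp only [whittakerWGeneric]
  rw [h1, h2]
  ring

/-- The recurrence for W, divided by e^{-z/2} z^{κ+1} and read off at (-z)^{-(n+2)}. -/
theorem whittakerCoeff_recurrence (κ μ : ℂ) (n : ℕ) :
    whittakerCoeff (κ + 1) (n + 2) μ = whittakerCoeff κ (n + 2) μ +
      2 * κ * whittakerCoeff κ (n + 1) μ -
        (1 / 2 + μ - κ) * (1 / 2 - μ - κ) * whittakerCoeff (κ - 1) n μ := by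
  have h1 : ((n : ℂ) + 1) ≠ 0 := by exact_mod_cast n.succ_ne_zero
  have h2 : ((n : ℂ) + 1 + 1) ≠ 0 := by exact_mod_cast (n + 1).succ_ne_zero
  have h3 : (n.factorial : ℂ) ≠ 0 := by exact_mod_cast n.factorial_ne_zero
  obtain ⟨a, ha⟩ : ∃ a, a = 1 / 2 + μ - κ := ⟨_, rfl⟩
  obtain ⟨d, hd⟩ : ∃ d, d = 1 / 2 - μ - κ := ⟨_, rfl⟩
  have hκ : 2 * κ = 1 - a - d := by rw [ha, hd]; ring
  have e1 : ∀ a : ℂ, (ascPochhammer ℂ (n + 2)).eval (a - 1) =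
      (a - 1) * (a * (ascPochhammer ℂ n).eval (a + 1)) := fun a => by
    rw [eval_ascPochhammer_succ_left, eval_ascPochhammer_succ_left, sub_add_cancel]
  have e2 : ∀ a : ℂ, (ascPochhammer ℂ (n + 2)).eval a =
      a * (ascPochhammer ℂ n).eval (a + 1) * (a + n + 1) := fun a => by
    rw [ascPochhammer_succ_eval, eval_ascPochhammer_succ_left]
    push_cast
    ring
  simp only [whittakerCoeff]
  rw [show 1 / 2 + μ - (κ + 1) = a - 1 by rw [ha]; ring,
    show 1 / 2 - μ - (κ + 1) = d - 1 by rw [hd]; ring,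
    show 1 / 2 + μ - (κ - 1) = a + 1 by rw [ha]; ring,
    show 1 / 2 - μ - (κ - 1) = d + 1 by rw [hd]; ring, ← ha, ← hd, hκ, e1, e1, e2, e2,
    eval_ascPochhammer_succ_left, eval_ascPochhammer_succ_left,
    show n + 2 = n + 1 + 1 from rfl, Nat.factorial_succ (n + 1), Nat.factorial_succ n]
  push_cast
  field_simp
  ring

/-- The factors u and u² shorten the truncations by one and two. Truncated subtraction is harmless:
for N ≤ 1 the affected sums are empty. -/
theorem sum_whittakerCoeff_recurrence (κ μ u : ℂ) (N : ℕ) :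
    ∑ n ∈ Finset.range N, whittakerCoeff (κ + 1) n μ * u ^ n =
      ∑ n ∈ Finset.range N, whittakerCoeff κ n μ * u ^ n +
      2 * κ * u * ∑ n ∈ Finset.range (N - 1), whittakerCoeff κ n μ * u ^ n -
      (1 / 2 + μ - κ) * (1 / 2 - μ - κ) * u ^ 2 *
        ∑ n ∈ Finset.range (N - 2), whittakerCoeff (κ - 1) n μ * u ^ n := by
  match N with
  | 0 => simp
  | 1 => simp [whittakerCoeff]
  | N + 2 =>
    induction N with
    | zero =>
      simp [whittakerCoeff, Finset.sum_range_succ]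
      ring
    | succ N ih =>
      have s1 : ∀ f : ℕ → ℂ, ∑ n ∈ Finset.range (N + 1), f n = ∑ n ∈ Finset.range N, f n + f N :=
        fun f => Finset.sum_range_succ f N
      have s2 : ∀ f : ℕ → ℂ, ∑ n ∈ Finset.range (N + 2), f n =
          ∑ n ∈ Finset.range N, f n + f N + f (N + 1) := fun f => by
        rw [Finset.sum_range_succ, s1]
      have s3 : ∀ f : ℕ → ℂ, ∑ n ∈ Finset.range (N + 1 + 2), f n =
          ∑ n ∈ Finset.range N, f n + f N + f (N + 1) + f (N + 2) := fun f => by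
        rw [Finset.sum_range_succ, s2]
      rw [show N + 2 - 1 = N + 1 from rfl, show N + 2 - 2 = N from rfl, s1, s2, s2] at ih
      rw [show N + 1 + 2 - 1 = N + 2 from rfl, show N + 1 + 2 - 2 = N + 1 from rfl, s1, s2, s3, s3,
        whittakerCoeff_recurrence]
      linear_combination ih

theorem whittakerRem_recurrence (κ : ℂ) (N : ℕ) (μ w : ℂ) :
    whittakerRem (κ + 1) N μ w = whittakerRem κ N μ w +
      2 * κ * (-cexp w)⁻¹ * whittakerRem κ (N - 1) μ w -
      (1 / 2 + μ - κ) * (1 / 2 - μ - κ) * (-cexp w)⁻¹ ^ 2 * whittakerRem (κ - 1) (N - 2) μ w := by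
  simp only [whittakerRem, ← inv_pow]
  rw [sum_whittakerCoeff_recurrence, whittakerWGeneric_recurrence]
  have e1 : cexp (-((κ + 1) * w)) = cexp (-(κ * w)) * (cexp w)⁻¹ := by
    rw [← Complex.exp_neg w, ← Complex.exp_add]
    ring_nf
  have e2 : cexp (-((κ - 1) * w)) = cexp (-(κ * w)) * cexp w := by
    rw [← Complex.exp_add]
    ring_nf
  have h0 := Complex.exp_ne_zero w
  rw [e1, e2]
  field_simp
  ring

/-- The remainders of order N-1 and N-2 enter with factors z⁻¹ and z⁻², which restore the order N;
`hN` covers small N through |z| ≥ 1. -/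
theorem WhittakerRemBound.add_one {κ : ℂ} {δ : ℝ} {K : ℕ}
    (h0 : ∀ N, WhittakerRemBound (κ - 1) δ K N) (h1 : ∀ N, WhittakerRemBound κ δ K N) (N : ℕ) :
    WhittakerRemBound (κ + 1) δ K N := by
  obtain ⟨C₀, hC₀, b₀⟩ := h0 (N - 2)
  obtain ⟨C₁, hC₁, b₁⟩ := h1 (N - 1)
  obtain ⟨C₂, hC₂, b₂⟩ := h1 N
  set A : ℝ := 1 / 2 + K + ‖κ‖ with hA
  refine ⟨C₂ + 2 * ‖κ‖ * C₁ + A * A * C₀, by positivity, fun μ hμ hs w hw hw0 => ?_⟩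
  have hu : ‖(-cexp w)⁻¹‖ = Real.exp (-w.re) := by
    rw [norm_inv, norm_neg, norm_exp, Real.exp_neg]
  have ha : ‖1 / 2 + μ - κ‖ ≤ A := by
    rw [hA]
    refine (norm_sub_le _ _).trans ?_
    gcongr
    refine (norm_add_le _ _).trans ?_
    gcongr
    simp
  have hd : ‖1 / 2 - μ - κ‖ ≤ A := by
    rw [hA]
    refine (norm_sub_le _ _).trans ?_
    gcongr
    refine (norm_sub_le _ _).trans ?_
    gcongr
    simp
  have hN : ∀ j : ℕ, Real.exp (-w.re) ^ j * Real.exp (-((N - j : ℕ) * w.re)) ≤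
      Real.exp (-(N * w.re)) := by
    intro j
    rw [← Real.exp_nat_mul, ← Real.exp_add, Real.exp_le_exp]
    have : (N : ℝ) ≤ (N - j : ℕ) + j := by exact_mod_cast (by omega : N ≤ N - j + j)
    nlinarith
  rw [whittakerRem_recurrence]
  have n2 := b₂ μ hμ hs w hw hw0
  have n1 : ‖2 * κ * (-cexp w)⁻¹ * whittakerRem κ (N - 1) μ w‖ ≤
      2 * ‖κ‖ * C₁ * Real.exp (-(N * w.re)) := by
    have h := b₁ μ hμ hs w hw hw0
    have h' := hN 1
    rw [pow_one] at h'
    rw [norm_mul, norm_mul, norm_mul, hu, norm_ofNat]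
    calc 2 * ‖κ‖ * Real.exp (-w.re) * ‖whittakerRem κ (N - 1) μ w‖
        ≤ 2 * ‖κ‖ * Real.exp (-w.re) * (C₁ * Real.exp (-((N - 1 : ℕ) * w.re))) := by gcongr
      _ = 2 * ‖κ‖ * C₁ * (Real.exp (-w.re) * Real.exp (-((N - 1 : ℕ) * w.re))) := by ring
      _ ≤ _ := by gcongr
  have n0 : ‖(1 / 2 + μ - κ) * (1 / 2 - μ - κ) * (-cexp w)⁻¹ ^ 2 *
      whittakerRem (κ - 1) (N - 2) μ w‖ ≤ A * A * C₀ * Real.exp (-(N * w.re)) := by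
    have h := b₀ μ hμ hs w hw hw0
    have h' := hN 2
    rw [norm_mul, norm_mul, norm_mul, norm_pow, hu]
    calc ‖1 / 2 + μ - κ‖ * ‖1 / 2 - μ - κ‖ * Real.exp (-w.re) ^ 2 *
          ‖whittakerRem (κ - 1) (N - 2) μ w‖
        ≤ A * A * Real.exp (-w.re) ^ 2 * (C₀ * Real.exp (-((N - 2 : ℕ) * w.re))) := by gcongr
      _ = A * A * C₀ * (Real.exp (-w.re) ^ 2 * Real.exp (-((N - 2 : ℕ) * w.re))) := by ring
      _ ≤ _ := by gcongr
  refine ((norm_sub_le _ _).trans (add_le_add ((norm_add_le _ _).trans (add_le_add n2 n1))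
    n0)).trans (le_of_eq ?_)
  ring

/-- For large k both κ-k-1 and κ-k satisfy the hypothesis of `whittakerRemBound_of_lt`. The
recurrence has order two, so the induction carries two consecutive values. -/
theorem whittakerRemBound (κ : ℂ) {δ : ℝ} (hδ : 0 < δ) (K N : ℕ) :
    WhittakerRemBound κ δ K N := by
  obtain ⟨k, hk⟩ := exists_nat_gt (K - 1 / 2 + κ.re)
  have key : ∀ j : ℕ, (∀ N, WhittakerRemBound (κ - k - 1 + j) δ K N) ∧
      ∀ N, WhittakerRemBound (κ - k + j) δ K N := by
    intro j
    induction j with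
    | zero =>
      refine ⟨whittakerRemBound_of_lt ?_ hδ, whittakerRemBound_of_lt ?_ hδ⟩
      · simp
        linarith
      · simp
        linarith
    | succ j ih =>
      have h := WhittakerRemBound.add_one (κ := κ - k + j)
        (by rw [show κ - k + j - 1 = κ - k - 1 + j by ring]; exact ih.1) ih.2
      refine ⟨?_, ?_⟩
      · rw [show κ - k - 1 + (j + 1 : ℕ) = κ - k + j by push_cast; ring]
        exact ih.2
      · rw [show κ - k + (j + 1 : ℕ) = κ - k + j + 1 by push_cast; ring]
        exact h
  simpa using (key k).2 N

/-! ### Entirety in `μ` -/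

theorem sin_two_pi_mul_eq_zero_iff (μ : ℂ) :
    Complex.sin (2 * Real.pi * μ) = 0 ↔ ∃ n : ℤ, 2 * μ = n := by
  have hpi : (Real.pi : ℂ) ≠ 0 := by exact_mod_cast Real.pi_ne_zero
  rw [Complex.sin_eq_zero_iff]
  refine exists_congr fun n => ⟨fun h => ?_, fun h => ?_⟩
  · exact mul_right_cancel₀ hpi (by linear_combination h)
  · linear_combination (Real.pi : ℂ) * h

/-- The numerator of the connection formula. -/
noncomputable def whittakerNum (κ μ w : ℂ) : ℂ :=
  whittakerMReg κ (-μ) w / Gamma (1 / 2 + μ - κ) - whittakerMReg κ μ w / Gamma (1 / 2 - μ - κ)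

theorem whittakerNum_neg (κ μ w : ℂ) : whittakerNum κ (-μ) w = -whittakerNum κ μ w := by
  simp only [whittakerNum, neg_neg, sub_neg_eq_add, ← sub_eq_add_neg]
  ring

theorem differentiable_whittakerNum (κ w : ℂ) : Differentiable ℂ fun μ => whittakerNum κ μ w := by
  have h1 := differentiable_whittakerMReg (κ := fun _ => κ) (μ := fun μ => μ) (w := fun _ => w)
    (by fun_prop) (by fun_prop) (by fun_prop)
  have h2 := differentiable_whittakerMReg (κ := fun _ => κ) (μ := fun μ => -μ) (w := fun _ => w)
    (by fun_prop) (by fun_prop) (by fun_prop)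
  have h3 : Differentiable ℂ fun μ => (Gamma (1 / 2 + μ - κ))⁻¹ :=
    differentiable_one_div_Gamma.comp (by fun_prop)
  have h4 : Differentiable ℂ fun μ => (Gamma (1 / 2 - μ - κ))⁻¹ :=
    differentiable_one_div_Gamma.comp (by fun_prop)
  unfold whittakerNum
  simp only [div_eq_mul_inv] at *
  exact (h2.mul h3).sub (h1.mul h4)

theorem Gamma_inv_eq_ascPochhammer_mul (a : ℂ) (n : ℕ) :
    (Gamma a)⁻¹ = (ascPochhammer ℂ n).eval a * (Gamma (a + n))⁻¹ := by
  induction n with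
  | zero => simp
  | succ n ih =>
    rw [ih, ascPochhammer_succ_eval, one_div_Gamma_eq_self_mul_one_div_Gamma_add_one]
    push_cast
    rw [add_assoc]
    ring

/-- The first n coefficients contain 1/Γ at nonpositive integers and vanish; the remaining ones are
a shifted Kummer series. -/
theorem kummerReg_one_sub_natCast (a z : ℂ) (n : ℕ) :
    kummerReg a (1 - n) z =
      (ascPochhammer ℂ n).eval a * z ^ n * kummerReg (a + n) (1 + n) z := by
  refine (hasSum_kummerReg a (1 - n) z).unique ?_
  have hz : ∑ i ∈ Finset.range n, kummerCoeff a (1 - n) i * z ^ i = 0 := by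
    refine Finset.sum_eq_zero fun i hi => ?_
    have hi' : i + 1 ≤ n := Finset.mem_range.1 hi
    obtain ⟨k, rfl⟩ := Nat.exists_eq_add_of_le hi'
    have : (1 : ℂ) - (i + 1 + k : ℕ) + i = -(k : ℂ) := by push_cast; ring
    rw [kummerCoeff, this, Gamma_neg_nat_eq_zero]
    simp
  have e : (fun i => kummerCoeff a (1 - n) (i + n) * z ^ (i + n)) = fun i =>
      (ascPochhammer ℂ n).eval a * z ^ n * (kummerCoeff (a + n) (1 + n) i * z ^ i) := by
    ext i
    have h1 : (ascPochhammer ℂ (i + n)).eval a =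
        (ascPochhammer ℂ n).eval a * (ascPochhammer ℂ i).eval (a + n) := by
      rw [add_comm, ← ascPochhammer_mul]
      simp
    have h2 : Gamma (1 - n + (i + n : ℕ)) = i.factorial := by
      rw [← Gamma_nat_eq_factorial]
      push_cast
      ring_nf
    have h3 : Gamma (1 + n + i) = (i + n).factorial := by
      rw [← Gamma_nat_eq_factorial]
      push_cast
      ring_nf
    rw [kummerCoeff, kummerCoeff, h1, h2, h3]
    ring
  rw [← hasSum_nat_add_iff' n, hz, sub_zero, e]
  exact (hasSum_kummerReg (a + n) (1 + n) z).mul_left _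

/-- For μ = n/2 the Frobenius solutions are proportional, and after division by the Gamma factors
they coincide. -/
theorem whittakerNum_natCast_div_two (κ w : ℂ) (n : ℕ) : whittakerNum κ (n / 2) w = 0 := by
  have h := kummerReg_one_sub_natCast (1 / 2 - n / 2 - κ) (cexp w) n
  have g := Gamma_inv_eq_ascPochhammer_mul (1 / 2 - n / 2 - κ) n
  rw [show (1 : ℂ) / 2 - n / 2 - κ + n = 1 / 2 + n / 2 - κ by ring] at h g
  have e : cexp ((1 / 2 + n / 2) * w) = cexp ((1 / 2 + -(n / 2)) * w) * cexp w ^ n := by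
    rw [← Complex.exp_nat_mul, ← Complex.exp_add]
    ring_nf
  rw [whittakerNum, whittakerMReg_eq, whittakerMReg_eq, div_eq_mul_inv _ (Gamma _),
    div_eq_mul_inv _ (Gamma _), g, e,
    show (1 : ℂ) + 2 * -(n / 2) = 1 - n by ring, show (1 : ℂ) + 2 * (n / 2) = 1 + n by ring,
    show (1 : ℂ) / 2 + -(n / 2) - κ = 1 / 2 - n / 2 - κ by ring, h]
  ring

theorem whittakerNum_eq_zero {κ μ w : ℂ} (h : Complex.sin (2 * Real.pi * μ) = 0) :
    whittakerNum κ μ w = 0 := by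
  obtain ⟨n, hn⟩ := (sin_two_pi_mul_eq_zero_iff μ).1 h
  obtain ⟨k, rfl | rfl⟩ := n.eq_nat_or_neg
  · rw [show μ = (k : ℂ) / 2 by push_cast at hn; linear_combination hn / 2]
    exact whittakerNum_natCast_div_two κ w k
  · rw [show μ = -((k : ℂ) / 2) by push_cast at hn; linear_combination hn / 2, whittakerNum_neg,
      whittakerNum_natCast_div_two, neg_zero]

theorem whittakerWGeneric_eq (κ μ w : ℂ) :
    whittakerWGeneric κ μ w = Real.pi / Complex.sin (2 * Real.pi * μ) * whittakerNum κ μ w := rfl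

theorem hasDerivAt_sin_two_pi_mul (μ : ℂ) : HasDerivAt (fun μ => Complex.sin (2 * Real.pi * μ))
    (Complex.cos (2 * Real.pi * μ) * (2 * Real.pi * 1)) μ :=
  ((hasDerivAt_id μ).const_mul (2 * Real.pi : ℂ)).csin

theorem cos_two_pi_mul_ne_zero {μ : ℂ} (h : Complex.sin (2 * Real.pi * μ) = 0) :
    Complex.cos (2 * Real.pi * μ) * (2 * Real.pi * 1) ≠ 0 := by
  have hpi : (Real.pi : ℂ) ≠ 0 := by exact_mod_cast Real.pi_ne_zero
  refine mul_ne_zero (fun hc => ?_) (by simp)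
  have := Complex.sin_sq_add_cos_sq (2 * Real.pi * μ)
  simp [h, hc] at this

theorem eventually_sin_two_pi_mul_ne_zero (μ : ℂ) :
    ∀ᶠ ν in 𝓝[≠] μ, Complex.sin (2 * Real.pi * ν) ≠ 0 := by
  by_cases h : Complex.sin (2 * Real.pi * μ) = 0
  · exact (hasDerivAt_sin_two_pi_mul μ).eventually_ne (cos_two_pi_mul_ne_zero h)
  · exact ((hasDerivAt_sin_two_pi_mul μ).continuousAt.eventually_ne h).filter_mono
      nhdsWithin_le_nhds

theorem whittakerW_of_sin_ne_zero {κ μ w : ℂ} (h : Complex.sin (2 * Real.pi * μ) ≠ 0) :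
    whittakerW κ μ w = whittakerWGeneric κ μ w := by
  rw [whittakerW, if_neg (by rwa [← sin_two_pi_mul_eq_zero_iff])]

theorem differentiableAt_whittakerWGeneric {κ μ w : ℂ} (h : Complex.sin (2 * Real.pi * μ) ≠ 0) :
    DifferentiableAt ℂ (fun μ => whittakerWGeneric κ μ w) μ := by
  simp only [whittakerWGeneric_eq]
  exact ((hasDerivAt_sin_two_pi_mul μ).differentiableAt.inv h |>.const_mul (Real.pi : ℂ)).mul
    (differentiable_whittakerNum κ w μ)

/-- The sine has a simple zero where the numerator vanishes, so the quotient is a ratio of slopes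
tending to a ratio of derivatives. -/
theorem tendsto_whittakerWGeneric {κ μ w : ℂ} (h : Complex.sin (2 * Real.pi * μ) = 0) :
    ∃ l, Tendsto (fun ν => whittakerWGeneric κ ν w) (𝓝[≠] μ) (𝓝 l) := by
  have h1 := hasDerivAt_iff_tendsto_slope.1 (differentiable_whittakerNum κ w μ).hasDerivAt
  have h2 := hasDerivAt_iff_tendsto_slope.1 (hasDerivAt_sin_two_pi_mul μ)
  refine ⟨_, ((h1.div h2 (cos_two_pi_mul_ne_zero h)).const_mul (Real.pi : ℂ)).congr' ?_⟩
  filter_upwards [self_mem_nhdsWithin] with ν hν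
  have hν' : ν - μ ≠ 0 := sub_ne_zero.2 hν
  rw [Pi.div_apply, slope_def_field, slope_def_field, h, whittakerNum_eq_zero h, sub_zero, sub_zero,
    whittakerWGeneric_eq, div_div_div_cancel_right₀ hν']
  ring

/-- `W_{κ,μ}` is an entire function of `μ`. -/
theorem differentiable_whittakerW (κ w : ℂ) : Differentiable ℂ fun μ => whittakerW κ μ w := by
  intro μ
  have hev := eventually_sin_two_pi_mul_ne_zero μ
  by_cases h : Complex.sin (2 * Real.pi * μ) = 0
  · obtain ⟨l, hl⟩ := tendsto_whittakerWGeneric (κ := κ) (w := w) h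
    obtain ⟨s, hs, hs'⟩ := (nhdsWithin_basis_open μ {μ}ᶜ).eventually_iff.1 hev
    have hd : DifferentiableOn ℂ (fun ν => whittakerWGeneric κ ν w) (s \ {μ}) := fun ν hν =>
      (differentiableAt_whittakerWGeneric (hs' hν)).differentiableWithinAt
    -- A finite limit gives boundedness near μ. Riemann's theorem then applies, and the value it
    -- fills in is the `limUnder` of the definition.
    have hbdd := (hl.sub_const (whittakerWGeneric κ μ w)).norm.isBoundedUnder_le
    have hu := differentiableOn_update_limUnder_of_isLittleO (hs.2.mem_nhds hs.1) hd
      hbdd.isLittleO_sub_self_inv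
    refine (hu.differentiableAt (hs.2.mem_nhds hs.1)).congr_of_eventuallyEq ?_
    filter_upwards [hs.2.mem_nhds hs.1] with ν hν
    by_cases hνμ : ν = μ
    · subst hνμ
      rw [Function.update_self, whittakerW, if_pos ((sin_two_pi_mul_eq_zero_iff ν).1 h)]
    · rw [Function.update_of_ne hνμ, whittakerW_of_sin_ne_zero (hs' ⟨hν, hνμ⟩)]
  · refine (differentiableAt_whittakerWGeneric (κ := κ) (w := w) h).congr_of_eventuallyEq ?_
    filter_upwards [(hasDerivAt_sin_two_pi_mul μ).continuousAt.eventually_ne h] with ν hν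
    exact whittakerW_of_sin_ne_zero hν

/-! ### Cauchy's estimate for the μ-derivatives -/

theorem differentiable_whittakerCoeff (κ : ℂ) (n : ℕ) : Differentiable ℂ (whittakerCoeff κ n) := by
  unfold whittakerCoeff
  refine Differentiable.div_const (Differentiable.mul ?_ ?_) _
  · exact (ascPochhammer ℂ n).differentiable.comp (by fun_prop)
  · exact (ascPochhammer ℂ n).differentiable.comp (by fun_prop)

/-- The remainder of the asymptotic expansion of `e^{z/2} z^{-κ} W_{κ,μ}(z)` as an entire function
of `μ`. -/
noncomputable def whittakerRemEntire (κ : ℂ) (N : ℕ) (w μ : ℂ) : ℂ :=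
  cexp (cexp w / 2) * cexp (-(κ * w)) * whittakerW κ μ w -
    ∑ n ∈ Finset.range N, ((-cexp w) ^ n)⁻¹ * whittakerCoeff κ n μ

theorem differentiable_whittakerRemEntire (κ : ℂ) (N : ℕ) (w : ℂ) :
    Differentiable ℂ (whittakerRemEntire κ N w) :=
  ((differentiable_whittakerW κ w).const_mul _).sub
    (Differentiable.fun_sum fun n _ => (differentiable_whittakerCoeff κ n).const_mul _)

theorem whittakerRemEntire_of_sin_ne_zero {κ μ w : ℂ} {N : ℕ}
    (h : Complex.sin (2 * Real.pi * μ) ≠ 0) :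
    whittakerRemEntire κ N w μ = whittakerRem κ N μ w := by
  rw [whittakerRemEntire, whittakerRem, whittakerW_of_sin_ne_zero h]
  congr 1
  exact Finset.sum_congr rfl fun n _ => mul_comm _ _

theorem iteratedDeriv_whittakerRemEntire (κ : ℂ) (N m : ℕ) (w μ : ℂ) :
    iteratedDeriv m (whittakerRemEntire κ N w) μ =
      cexp (cexp w / 2) * cexp (-(κ * w)) * iteratedDeriv m (fun ν => whittakerW κ ν w) μ -
        ∑ n ∈ Finset.range N, ((-cexp w) ^ n)⁻¹ * iteratedDeriv m (whittakerCoeff κ n) μ := by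
  have h1 : Differentiable ℂ fun μ =>
      cexp (cexp w / 2) * cexp (-(κ * w)) * whittakerW κ μ w :=
    (differentiable_whittakerW κ w).const_mul _
  have h2 : ∀ n, Differentiable ℂ fun μ => ((-cexp w) ^ n)⁻¹ * whittakerCoeff κ n μ := fun n =>
    (differentiable_whittakerCoeff κ n).const_mul _
  have h3 : Differentiable ℂ fun μ =>
      ∑ n ∈ Finset.range N, ((-cexp w) ^ n)⁻¹ * whittakerCoeff κ n μ :=
    Differentiable.fun_sum fun n _ => h2 n
  have e := iteratedDeriv_sub (n := m) (x := μ) h1.contDiff.contDiffAt h3.contDiff.contDiffAt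
  rw [iteratedDeriv_fun_sum (fun n _ => (h2 n).contDiff.contDiffAt),
    iteratedDeriv_const_mul_field] at e
  simp only [iteratedDeriv_const_mul_field] at e
  exact e

/-- `W_{κ,μ}(z)` is entire in `μ`, and for each `m` the asymptotic expansion of
`∂_μ^m W_{κ,μ}(z)` as `|z| → ∞` in `|arg z| ≤ 3π/2 - δ` is the term-by-term derivative of the one of
`W_{κ,μ}(z)`, uniformly for `μ` in a bounded neighbourhood `U` of `μ₀`. Here `z = e^w`, so that
`|z| = exp (Re w)` and `arg z = Im w`, and `z ^ κ = e^{κ w}`. -/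
theorem mainTheorem8 (κ : ℂ) :
    (∀ w : ℂ, Differentiable ℂ (fun μ : ℂ => whittakerW κ μ w)) ∧
    ∀ (δ : ℝ), 0 < δ → ∀ (μ₀ : ℂ) (U : Set ℂ), IsOpen U → μ₀ ∈ U → Bornology.IsBounded U →
      ∀ (m N : ℕ), ∃ C R : ℝ, 0 < R ∧
        ∀ μ ∈ U, ∀ w : ℂ, |w.im| ≤ 3 * Real.pi / 2 - δ → R ≤ Real.exp w.re →
          ‖iteratedDeriv m (fun ν : ℂ => whittakerW κ ν w) μ -
              Complex.exp (-Complex.exp w / 2) * Complex.exp (κ * w) *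
                ∑ n ∈ Finset.range N,
                  iteratedDeriv m (whittakerCoeff κ n) μ * ((-Complex.exp w) ^ n)⁻¹‖ ≤
            C * ‖Complex.exp (-Complex.exp w / 2) * Complex.exp (κ * w)‖ *
              (Real.exp w.re ^ N)⁻¹ := by
  refine ⟨differentiable_whittakerW κ, fun δ hδ μ₀ U _ _ hU m N => ?_⟩
  obtain ⟨B, hB⟩ := hU.exists_norm_le
  -- The margin 1 keeps the unit circle around each μ ∈ U inside the disc of radius K.
  obtain ⟨K, hK⟩ := exists_nat_gt (B + 1)
  obtain ⟨C, hC, hbound⟩ := whittakerRemBound κ hδ K N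
  refine ⟨m.factorial * C, 1, one_pos, fun μ hμ w hw hw1 => ?_⟩
  have hw0 : 0 ≤ w.re := Real.one_le_exp_iff.1 hw1
  -- Every ν is a limit of indices with nonvanishing sine, so continuity of the remainder carries
  -- the bound to the exceptional ν.
  have hball : ∀ ν : ℂ, ‖ν‖ < K → ‖whittakerRemEntire κ N w ν‖ ≤ C * Real.exp (-(N * w.re)) := by
    intro ν hν
    have hcont := ((differentiable_whittakerRemEntire κ N w).continuous.norm.tendsto ν).mono_left
      (nhdsWithin_le_nhds (s := {ν}ᶜ))
    refine le_of_tendsto hcont ?_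
    have hn : ∀ᶠ ξ : ℂ in 𝓝[≠] ν, ‖ξ‖ < K :=
      (continuous_norm.tendsto ν).mono_left nhdsWithin_le_nhds |>.eventually_lt_const hν
    filter_upwards [hn, eventually_sin_two_pi_mul_ne_zero ν] with ξ h1 h2
    rw [whittakerRemEntire_of_sin_ne_zero h2]
    exact hbound ξ h1.le h2 w hw hw0
  have hcauchy := norm_iteratedDeriv_le_of_forall_mem_sphere_norm_le m one_pos
    (differentiable_whittakerRemEntire κ N w).diffContOnCl (c := μ) fun ν hν => hball ν ?_
  swap
  · have h1 := norm_le_norm_add_norm_sub' ν μ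
    rw [mem_sphere_iff_norm.1 hν] at h1
    linarith [hB μ hμ]
  rw [one_pow, div_one] at hcauchy
  have hY : cexp (-cexp w / 2) * cexp (κ * w) * (cexp (cexp w / 2) * cexp (-(κ * w))) = 1 := by
    rw [← Complex.exp_add, ← Complex.exp_add, ← Complex.exp_add]
    ring_nf
    simp
  have hE : (Real.exp w.re ^ N)⁻¹ = Real.exp (-(N * w.re)) := by
    rw [← Real.exp_nat_mul, Real.exp_neg]
  have hsum : ∑ n ∈ Finset.range N, iteratedDeriv m (whittakerCoeff κ n) μ * ((-cexp w) ^ n)⁻¹ =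
      ∑ n ∈ Finset.range N, ((-cexp w) ^ n)⁻¹ * iteratedDeriv m (whittakerCoeff κ n) μ :=
    Finset.sum_congr rfl fun n _ => mul_comm _ _
  have heq : iteratedDeriv m (fun ν : ℂ => whittakerW κ ν w) μ -
      cexp (-cexp w / 2) * cexp (κ * w) * ∑ n ∈ Finset.range N,
        iteratedDeriv m (whittakerCoeff κ n) μ * ((-cexp w) ^ n)⁻¹ =
      cexp (-cexp w / 2) * cexp (κ * w) * iteratedDeriv m (whittakerRemEntire κ N w) μ := by
    rw [iteratedDeriv_whittakerRemEntire, hsum]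
    linear_combination -(iteratedDeriv m (fun ν : ℂ => whittakerW κ ν w) μ) * hY
  rw [heq, norm_mul, hE]
  calc _ ≤ ‖cexp (-cexp w / 2) * cexp (κ * w)‖ * (m.factorial * (C * Real.exp (-(N * w.re)))) := by
        gcongr
    _ = _ := by ring
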